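/- Let $\gamma\in(0,1)$ and $d\ge 1$. Let $\mathscr F_d$ be the set of forests (multisets) of non-planar rooted trees with vertices labelled by $\{1,\dots,d\}$, let $\mathscr T_d\subset\mathscr F_d$ be the trees, $|\zeta|$ the number of vertices of $\zeta$, $\lfloor\zeta\rfloor_i$ the tree obtained by joining the trees of $\zeta$ to a new root labelled $i$, and $\mathbf 1$ the empty forest. Let $\langle\mathscr F_d\rangle$ be the free real vector space on $\mathscr F_d$ with the commutative product $\odot$ given by union of forests, and let $\Delta:\langle\mathscr F_d\rangle\to\langle\mathscr F_d\rangle\otimes\langle\mathscr F_d\rangle$ be the Connes–Kreimer coproduct, i.e. the algebra morphism with $\Delta\lfloor\zeta\rfloor_i=\lfloor\zeta\rfloor_i\otimes\mathbf 1+(\mathrm{id}\otimes\lfloor\cdot\rfloor_i)\Delta\zeta$. The branched rough path regularity structure $\mathcal T^{\mathrm b}$ has the model space $T^{\mathrm b}=\langle\mathcal Y\rangle\oplus\langle\dot{\mathcal Y}\rangle$ spanned by the symbols $\mathcal Y=\{\mathbf 1\}\cup\mathscr T_d$ and $\dot{\mathcal Y}=\{\zeta\Xi_i:\zeta\in\mathscr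 F_d,\ 1\le i\le d\}$, with homogeneities $0$ for $\mathbf 1$, $\gamma|\tau|$ for $\tau\in\mathscr T_d$, $\gamma|\zeta|+\gamma-1$ for $\zeta\Xi_i$, and index set $A=\gamma\mathbb N_0\cup(\gamma\mathbb N-1)$. Let $T_\beta$ be the span of the symbols of homogeneity $\beta$, with the Euclidean norm $\|\cdot\|_\beta$ for which these symbols are orthonormal; let $\pi_\beta$ be the projection of $T^{\mathrm b}$ onto $T_\beta$, $\|x\|_\beta:=\|\pi_\beta x\|_\beta$, and let $\pi_{<\eta}$ be the projection onto the span $T_{<\eta}$ of the symbols of homogeneity $<\eta$. The structure group $G$ consists of the maps $(g\otimes\mathrm{id})\Delta^{\mathrm b}$, $g$ a (unital) character of $(\langle\mathscr F_d\rangle,\odot)$, where $\Delta^{\mathrm b}=\Delta$ on $\langle\mathcal Y\rangle$ and $\Delta^{\mathrm b}(\zeta\Xi_i)=\sum\zeta_1\otimes\zeta_2\Xi_i$ if $\Delta\zeta=\sum\zeta_1\otimes\zeta_2$. A model $(\Pi,\Gamma)\in\mathscr M^{\mathrm b}(\mathbb R)$ consists of linear maps $\Pi_s:T^{\mathrm b}\to\mathscr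 S'(\mathbb R)$ and of $\Gamma_{st}\in G$ ($s,t\in\mathbb R$) such that $\Gamma_{ss}=\mathrm{id}$, $\Gamma_{su}\Gamma_{ut}=\Gamma_{st}$, $\Pi_s\Gamma_{st}=\Pi_t$, and for every compact $\mathfrak K\subset\mathbb R$ and every $\beta\in A$ there is a constant $C$ such that, for all $s,t\in\mathfrak K$ and $a\in T_\beta$: $\|\Gamma_{st}a\|_\theta\le C\|a\|_\beta|t-s|^{\beta-\theta}$ for all $\theta\in A$ with $\theta<\beta$, and $|(\Pi_sa)(\delta^{-1}u(\delta^{-1}(\cdot-s)))|\le C\|a\|_\beta\,\delta^\beta$ for all $\delta\in(0,1]$ and all smooth $u$ compactly supported in $(-1,1)$ with $\|u\|_{C^r}\le1$, where $r$ is the smallest integer with $r>|\min A|=1-\gamma$. For $V\in\{\langle\mathcal Y\rangle,\langle\dot{\mathcal Y}\rangle\}$ and $\eta>\min A$, the space $\mathcal D^\eta_\Gamma(\mathbb R,V)$ consists of all $F:\mathbb R\to V\cap T_{<\eta}$ with $$|||F|||_{\eta,\mathfrak K}:=\sup_{t\in\mathfrak K}\sup_{\beta\in A,\,\beta<\eta}\|F(t)\|_\beta+\sup_{\substack{s,t\in\mathfrak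 K\\0<|t-s|\le1}}\ \sup_{\beta\in A,\,\beta<\eta}\frac{\|F(t)-\Gamma_{ts}F(s)\|_\beta}{|t-s|^{\eta-\beta}}<\infty$$ for all compact $\mathfrak K\subset\mathbb R$; it carries the topology of the seminorms $|||\cdot|||_{\eta,\mathfrak K}$. **Theorem.** Let $\alpha>0$, let $f\in C^k(\mathbb R,\mathbb R)$ for some $k\in\mathbb N$ with $k\ge\alpha/\gamma+1$, let $(\Pi,\Gamma)\in\mathscr M^{\mathrm b}(\mathbb R)$ and $i\in\{1,\dots,d\}$. For $Y\in\mathcal D^\alpha_\Gamma(\mathbb R,\langle\mathcal Y\rangle)$ put $$(f(Y)\Xi_i)_{\alpha+\gamma-1}(t):=\sum_{n=0}^{\lfloor\alpha/\gamma\rfloor}\pi_{<\alpha+\gamma-1}\,\frac{f^{(n)}(Y^{\mathbf 1}(t))}{n!}\,\bigl(Y(t)-Y^{\mathbf 1}(t)\mathbf 1\bigr)^{\odot n}\,\Xi_i,$$ where $Y^{\mathbf 1}(t)\mathbf 1:=\pi_0Y(t)$. Then $Y\mapsto(f(Y)\Xi_i)_{\alpha+\gamma-1}$ is a continuous map from $\mathcal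 D^\alpha_\Gamma(\mathbb R,\langle\mathcal Y\rangle)$ into $\mathcal D^{\alpha+\gamma-1}_\Gamma(\mathbb R,\langle\dot{\mathcal Y}\rangle)$. More precisely, for every compact $\mathfrak K\subset\mathbb R$ and every $D>0$ there is $C_{\mathfrak K,D}>0$ such that $$|||(f(F)\Xi_i)_{\alpha+\gamma-1}-(f(G)\Xi_i)_{\alpha+\gamma-1}|||_{\alpha+\gamma-1,\mathfrak K}\le C_{\mathfrak K,D}\,|||F-G|||_{\alpha,\mathfrak K}$$ for all $F,G\in\mathcal D^\alpha_\Gamma(\mathbb R,\langle\mathcal Y\rangle)$ with $|||F|||_{\alpha,\mathfrak K}+|||G|||_{\alpha,\mathfrak K}\le D$. -/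

import Mathlib

open scoped TensorProduct SchwartzMap ENNReal

namespace BranchedRS

noncomputable section

/-! ### Regularity-structure notions over a graded space of symbols

Throughout, the model space is the space `S →₀ ℝ` freely spanned by a set `S` of symbols, graded by
a homogeneity `deg : S → ℝ`. Its index set is `Set.range deg`, and `T_β` is the span of the symbols
of homogeneity `β`, equipped with the norm for which the symbols are orthonormal. -/

section General

variable {S : Type}

/-- The index set `A` of homogeneities. -/
def indexSet (deg : S → ℝ) : Set ℝ := Set.range deg

/-- `T_β`, the homogeneous subspace of homogeneity `β`. -/
def homog (deg : S → ℝ) (β : ℝ) : Submodule ℝ (S →₀ ℝ) :=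
  Finsupp.supported ℝ ℝ {σ | deg σ = β}

/-- `T_{<η}`, the direct sum of all `T_β` with `β < η`. -/
def below (deg : S → ℝ) (η : ℝ) : Submodule ℝ (S →₀ ℝ) :=
  Finsupp.supported ℝ ℝ {σ | deg σ < η}

open scoped Classical in
/-- The projection `π_{<η}` of `T` onto `T_{<η}`. -/
def projBelow (deg : S → ℝ) (η : ℝ) (x : S →₀ ℝ) : S →₀ ℝ :=
  x.filter (fun σ => deg σ < η)

open scoped Classical in
/-- The projection `π_β` of `T` onto `T_β`. -/
def projHomog (deg : S → ℝ) (β : ℝ) (x : S →₀ ℝ) : S →₀ ℝ :=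
  x.filter (fun σ => deg σ = β)

/-- The seminorm `‖x‖_β = ‖π_β x‖_β`; on `T_β` it is the Euclidean norm in the basis of symbols. -/
def homNorm (deg : S → ℝ) (β : ℝ) (x : S →₀ ℝ) : ℝ :=
  Real.sqrt ((projHomog deg β x).sum fun _ c => c ^ 2)

/-- A `G`-bimap over `ℝ`. -/
structure IsBimap (deg : S → ℝ) (G : Set ((S →₀ ℝ) →ₗ[ℝ] (S →₀ ℝ)))
    (Γ : ℝ → ℝ → ((S →₀ ℝ) →ₗ[ℝ] (S →₀ ℝ))) : Prop where
  mem : ∀ x y, Γ x y ∈ G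
  self : ∀ x, Γ x x = LinearMap.id
  comp : ∀ x y z, Γ x y ∘ₗ Γ y z = Γ x z
  bound : ∀ K : Set ℝ, IsCompact K → ∀ β ∈ indexSet deg, ∃ C : ℝ, ∀ x ∈ K, ∀ y ∈ K,
    ∀ a ∈ homog deg β, ∀ θ ∈ indexSet deg, θ < β →
      homNorm deg θ (Γ x y a) ≤ C * homNorm deg β a * dist x y ^ (β - θ)

/-- The rescaled test function `y ↦ δ⁻¹ u (δ⁻¹ (y - x))`. -/
def rescale (x : ℝ) (δ : ℝ) (hδ : 0 < δ) (u : 𝓢(ℝ, ℝ)) : 𝓢(ℝ, ℝ) :=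
  δ⁻¹ • SchwartzMap.compSubConstCLM ℝ x
    (SchwartzMap.compCLMOfContinuousLinearEquiv ℝ
      (ContinuousLinearEquiv.unitsEquivAut ℝ (Units.mk0 δ⁻¹ (inv_ne_zero hδ.ne'))) u)

theorem rescale_apply (x : ℝ) (δ : ℝ) (hδ : 0 < δ) (u : 𝓢(ℝ, ℝ)) (y : ℝ) :
    rescale x δ hδ u y = δ⁻¹ * u (δ⁻¹ * (y - x)) := by
  simp [rescale, mul_comm]

/-- Test functions compactly supported in the open unit ball with `C^r` norm at most one. -/
def testFunctions (r : ℕ) : Set 𝓢(ℝ, ℝ) :=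
  {u | tsupport u ⊆ Metric.ball 0 1 ∧ ∀ n ≤ r, ∀ x, |iteratedDeriv n u x| ≤ 1}

/-- The smallest natural number `r` with `r > |min A|`. -/
def testOrder (deg : S → ℝ) : ℕ := sInf {r : ℕ | |sInf (indexSet deg)| < r}

/-- Models on `ℝ` for the regularity structure with homogeneity `deg` and structure group `G`.
The map `Pi x` takes values in the (real) tempered distributions; as the homogeneous subspaces are
finite-dimensional in the case of interest, no continuity in the first argument has to be added. -/
structure Model (deg : S → ℝ) (G : Set ((S →₀ ℝ) →ₗ[ℝ] (S →₀ ℝ))) where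
  Pi : ℝ → ((S →₀ ℝ) →ₗ[ℝ] (𝓢(ℝ, ℝ) →L[ℝ] ℝ))
  Gam : ℝ → ℝ → ((S →₀ ℝ) →ₗ[ℝ] (S →₀ ℝ))
  isBimap : IsBimap deg G Gam
  compat : ∀ x y, Pi x ∘ₗ Gam x y = Pi y
  bound : ∀ K : Set ℝ, IsCompact K → ∀ β ∈ indexSet deg, ∃ C : ℝ, ∀ x ∈ K,
    ∀ (δ : ℝ) (hδ : 0 < δ), δ ≤ 1 → ∀ a ∈ homog deg β, ∀ u ∈ testFunctions (testOrder deg),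
      |Pi x a (rescale x δ hδ u)| ≤ C * homNorm deg β a * δ ^ β

/-- The (possibly infinite) quantity `|||F|||_{η,K}` of a map `F : ℝ → T`. -/
def mdNorm (deg : S → ℝ) (Γ : ℝ → ℝ → ((S →₀ ℝ) →ₗ[ℝ] (S →₀ ℝ))) (η : ℝ) (K : Set ℝ)
    (F : ℝ → (S →₀ ℝ)) : ℝ≥0∞ :=
  (⨆ x ∈ K, ⨆ β ∈ indexSet deg ∩ Set.Iio η, ENNReal.ofReal (homNorm deg β (F x))) +
  ⨆ x ∈ K, ⨆ y ∈ K, ⨆ (_ : 0 < dist x y ∧ dist x y ≤ 1), ⨆ β ∈ indexSet deg ∩ Set.Iio η,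
    ENNReal.ofReal (homNorm deg β (F x - Γ x y (F y)) / dist x y ^ (η - β))

/-- The space `D^η_Γ(ℝ, V)` of modelled distributions of order `η` with values in `V_{<η}`. -/
structure ModelledDistribution (deg : S → ℝ) (Γ : ℝ → ℝ → ((S →₀ ℝ) →ₗ[ℝ] (S →₀ ℝ)))
    (V : Submodule ℝ (S →₀ ℝ)) (η : ℝ) where
  toFun : ℝ → (S →₀ ℝ)
  mem : ∀ t, toFun t ∈ V ⊓ below deg η
  finite : ∀ K : Set ℝ, IsCompact K → mdNorm deg Γ η K toFun < ⊤

instance (deg : S → ℝ) (Γ : ℝ → ℝ → ((S →₀ ℝ) →ₗ[ℝ] (S →₀ ℝ)))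
    (V : Submodule ℝ (S →₀ ℝ)) (η : ℝ) :
    CoeFun (ModelledDistribution deg Γ V η) (fun _ => ℝ → (S →₀ ℝ)) :=
  ⟨ModelledDistribution.toFun⟩

/-- The topology of the family of seminorms `|||·|||_{η,K}`, `K` compact. -/
instance (deg : S → ℝ) (Γ : ℝ → ℝ → ((S →₀ ℝ) →ₗ[ℝ] (S →₀ ℝ)))
    (V : Submodule ℝ (S →₀ ℝ)) (η : ℝ) :
    TopologicalSpace (ModelledDistribution deg Γ V η) :=
  TopologicalSpace.generateFrom
    {U | ∃ (K : Set ℝ) (F : ModelledDistribution deg Γ V η) (ε : ℝ≥0∞), IsCompact K ∧ 0 < ε ∧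
      U = {H : ModelledDistribution deg Γ V η |
        mdNorm deg Γ η K (fun t => H t - F t) < ε}}

end General

/-! ### Decorated trees and forests -/

section Trees

/-- The functor sending `α` to pairs of a label and a multiset of elements of `α`. -/
def Branch (d : ℕ) (α : Type) : Type := Fin d × Multiset α

instance (d : ℕ) : Functor (Branch d) where
  map f p := (p.1, p.2.map f)

instance (d : ℕ) : QPF (Branch d) where
  P := ⟨Fin d × ℕ, fun p => Fin p.2⟩
  abs := fun p => (p.1.1, (List.ofFn p.2 : Multiset _))
  repr := fun x => ⟨(x.1, x.2.toList.length), fun j => x.2.toList.get j⟩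
  abs_repr := by
    intro α x
    change (x.1, ((List.ofFn x.2.toList.get : List α) : Multiset α)) = x
    rw [List.ofFn_get, Multiset.coe_toList]
    rfl
  abs_map := by
    intro α β f p
    change (p.1.1, ((List.ofFn (f ∘ p.2) : List β) : Multiset β)) =
      (p.1.1, Multiset.map f ((List.ofFn p.2 : List α) : Multiset α))
    rw [Multiset.map_coe, List.map_ofFn]

/-- Non-planar rooted trees with vertices decorated by `{1, …, d}`: a tree is a label of its root
together with the multiset of its branches (initial algebra of `Branch d`). -/
def Tree (d : ℕ) : Type := QPF.Fix (Branch d)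

/-- Forests are multisets of trees; the product `⊙` is the sum of multisets and the empty forest
`𝟏` is the empty multiset. -/
abbrev Forest (d : ℕ) : Type := Multiset (Tree d)

variable {d : ℕ}

/-- The tree `⌊ζ⌋_i` obtained by joining the trees of `ζ` to a new root labelled `i`. -/
def node (i : Fin d) (ζ : Forest d) : Tree d := QPF.Fix.mk (F := Branch d) (i, ζ)

/-- The label of the root. -/
def rootLabel (τ : Tree d) : Fin d := (QPF.Fix.dest (F := Branch d) τ).1

/-- The forest of branches at the root. -/
def branches (τ : Tree d) : Forest d := (QPF.Fix.dest (F := Branch d) τ).2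

theorem rootLabel_node (i : Fin d) (ζ : Forest d) : rootLabel (node i ζ) = i :=
  congrArg Prod.fst (QPF.Fix.dest_mk (F := Branch d) (i, ζ))

theorem branches_node (i : Fin d) (ζ : Forest d) : branches (node i ζ) = ζ :=
  congrArg Prod.snd (QPF.Fix.dest_mk (F := Branch d) (i, ζ))

theorem node_rootLabel_branches (τ : Tree d) : node (rootLabel τ) (branches τ) = τ :=
  QPF.Fix.mk_dest (F := Branch d) τ

theorem Tree.induction {p : Tree d → Prop}
    (h : ∀ i ζ, (∀ τ ∈ ζ, p τ) → p (node i ζ)) (τ : Tree d) : p τ := by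
  refine QPF.Fix.ind (F := Branch d) p ?_ τ
  rintro ⟨i, ζ⟩ ⟨⟨j, u⟩, hu⟩
  have h2 : Multiset.map Subtype.val u = ζ := congrArg Prod.snd hu
  refine h i ζ fun τ hτ => ?_
  rw [← h2] at hτ
  obtain ⟨σ, -, rfl⟩ := Multiset.mem_map.1 hτ
  exact σ.2

/-- Recursion on trees. -/
def Tree.fold {β : Type} (g : Fin d → Multiset β → β) : Tree d → β :=
  QPF.Fix.rec (F := Branch d) (fun p => g p.1 p.2)

theorem Tree.fold_node {β : Type} (g : Fin d → Multiset β → β) (i : Fin d) (ζ : Forest d) :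
    Tree.fold g (node i ζ) = g i (ζ.map (Tree.fold g)) :=
  QPF.Fix.rec_eq (F := Branch d) (fun p => g p.1 p.2) (i, ζ)

/-- The number of vertices of a tree. -/
def Tree.size : Tree d → ℕ := Tree.fold fun _ s => s.sum + 1

/-- The number of vertices of a forest. -/
def forestSize (ζ : Forest d) : ℕ := (ζ.map Tree.size).sum

theorem size_node (i : Fin d) (ζ : Forest d) : (node i ζ).size = forestSize ζ + 1 :=
  Tree.fold_node _ i ζ

/-! ### The Connes-Kreimer Hopf algebra -/

/-- The algebra `⟨F_d⟩` of linear combinations of forests with product `⊙`. -/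
abbrev ForestAlg (d : ℕ) : Type := AddMonoidAlgebra ℝ (Forest d)

/-- A forest as an element of the forest algebra. -/
def ofForest (ζ : Forest d) : ForestAlg d := AddMonoidAlgebra.single ζ 1

/-- The linear map on the forest algebra with prescribed values on forests. -/
def linExt {M : Type} [AddCommGroup M] [Module ℝ M] (φ : Forest d → M) : ForestAlg d →ₗ[ℝ] M :=
  Finsupp.linearCombination ℝ φ ∘ₗ (AddMonoidAlgebra.coeffLinearEquiv ℝ).toLinearMap

theorem linExt_ofForest {M : Type} [AddCommGroup M] [Module ℝ M] (φ : Forest d → M)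
    (ζ : Forest d) : linExt φ (ofForest ζ) = φ ζ := by
  simp [linExt, ofForest]

/-- The linear extension of `⌊·⌋_i`. -/
def graft (i : Fin d) : ForestAlg d →ₗ[ℝ] ForestAlg d := linExt fun ζ => ofForest {node i ζ}

/-- The pair of a tree `τ` and its coproduct, by recursion on `τ`. -/
def coprodTreeAux : Tree d → Tree d × (ForestAlg d ⊗[ℝ] ForestAlg d) :=
  Tree.fold fun i s =>
    (node i (s.map Prod.fst),
      ofForest {node i (s.map Prod.fst)} ⊗ₜ[ℝ] 1 +
        (graft i).lTensor (ForestAlg d) (s.map Prod.snd).prod)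

/-- The coproduct of a tree, see `coprodTree_node`. -/
def coprodTree (τ : Tree d) : ForestAlg d ⊗[ℝ] ForestAlg d := (coprodTreeAux τ).2

/-- The Connes-Kreimer coproduct, the algebra morphism extending `coprodTree`. -/
def coprod : ForestAlg d →ₐ[ℝ] ForestAlg d ⊗[ℝ] ForestAlg d :=
  AddMonoidAlgebra.lift ℝ (ForestAlg d ⊗[ℝ] ForestAlg d) (Forest d)
    { toFun := fun ζ => ((Multiplicative.toAdd ζ).map coprodTree).prod
      map_one' := by simp
      map_mul' := by simp }

theorem coprod_ofForest (ζ : Forest d) : coprod (ofForest ζ) = (ζ.map coprodTree).prod := by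
  rw [coprod, ofForest, AddMonoidAlgebra.lift_single, one_smul]
  rfl

theorem coprodTreeAux_fst (τ : Tree d) : (coprodTreeAux τ).1 = τ := by
  induction τ using Tree.induction with
  | h i ζ ih =>
    have h : (ζ.map coprodTreeAux).map Prod.fst = ζ := by
      rw [Multiset.map_map]
      conv_rhs => rw [← Multiset.map_id ζ]
      exact Multiset.map_congr rfl ih
    unfold coprodTreeAux at h ⊢
    rw [Tree.fold_node, h]

/-- The defining recursion `Δ⌊ζ⌋_i = ⌊ζ⌋_i ⊗ 𝟏 + (id ⊗ ⌊·⌋_i) Δζ`. -/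
theorem coprodTree_node (i : Fin d) (ζ : Forest d) :
    coprodTree (node i ζ) =
      ofForest {node i ζ} ⊗ₜ[ℝ] 1 + (graft i).lTensor (ForestAlg d) (coprod (ofForest ζ)) := by
  have h : (ζ.map coprodTreeAux).map Prod.fst = ζ := by
    rw [Multiset.map_map]
    conv_rhs => rw [← Multiset.map_id ζ]
    exact Multiset.map_congr rfl fun τ _ => coprodTreeAux_fst τ
  have h2 : (ζ.map coprodTreeAux).map Prod.snd = ζ.map coprodTree := by
    rw [Multiset.map_map]; rfl
  rw [coprod_ofForest, ← h2]
  unfold coprodTree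
  unfold coprodTreeAux at h ⊢
  rw [Tree.fold_node, h]

end Trees

/-! ### The branched rough path regularity structure -/

section Branched

/-- The symbols `𝟏`, `τ` (trees) and `ζ Ξ_i` (forest `ζ`, label `i`). -/
inductive Sym (d : ℕ) : Type
  | unit : Sym d
  | tree (τ : Tree d) : Sym d
  | noise (ζ : Forest d) (i : Fin d) : Sym d

variable {d : ℕ}

/-- Homogeneities: `|𝟏| = 0`, `|τ| = γ·size`, `|ζ Ξ_i| = γ·size + γ - 1`. -/
def homogeneity (γ : ℝ) : Sym d → ℝ
  | .unit => 0
  | .tree τ => γ * τ.size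
  | .noise ζ _ => γ * forestSize ζ + γ - 1

/-- The model space `T^b`. -/
abbrev ModelSpace (d : ℕ) : Type := Sym d →₀ ℝ

/-- The sector `⟨𝒴⟩` spanned by `𝟏` and the trees. -/
def sectorY (d : ℕ) : Submodule ℝ (ModelSpace d) :=
  Finsupp.supported ℝ ℝ {σ | σ = .unit ∨ ∃ τ, σ = .tree τ}

/-- The sector `⟨𝒴̇⟩` spanned by the symbols `ζ Ξ_i`. -/
def sectorYdot (d : ℕ) : Submodule ℝ (ModelSpace d) :=
  Finsupp.supported ℝ ℝ {σ | ∃ ζ i, σ = .noise ζ i}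

/-- Multiplication by `Ξ_i`, the linear map `ζ ↦ ζ Ξ_i`. -/
def mulXi (i : Fin d) : ForestAlg d →ₗ[ℝ] ModelSpace d :=
  linExt fun ζ => Finsupp.single (.noise ζ i) 1

/-- The linear map `ζ ↦ ⌊ζ⌋_i`, with `⌊ζ⌋_i` regarded as a symbol of the model space. -/
def graftSym (i : Fin d) : ForestAlg d →ₗ[ℝ] ModelSpace d :=
  linExt fun ζ => Finsupp.single (.tree (node i ζ)) 1

/-- The identification of `⟨𝒴⟩` with a subspace of the forest algebra (extended by zero to the
symbols `ζ Ξ_i`). -/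
def toForestAlg : ModelSpace d →ₗ[ℝ] ForestAlg d :=
  Finsupp.linearCombination ℝ fun
    | .unit => 1
    | .tree τ => ofForest {τ}
    | .noise _ _ => 0

/-- The comodule map `Δ^b : T^b → ⟨F_d⟩ ⊗ T^b`: on `ζ Ξ_i` it is `Δ` applied to `ζ`, and on `⟨𝒴⟩` it
is `Δ` itself (see `toForestAlg_coaction_tree`). -/
def coaction : ModelSpace d →ₗ[ℝ] ForestAlg d ⊗[ℝ] ModelSpace d :=
  Finsupp.linearCombination ℝ fun
    | .unit => 1 ⊗ₜ[ℝ] Finsupp.single .unit 1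
    | .tree τ => ofForest {τ} ⊗ₜ[ℝ] Finsupp.single .unit 1 +
        (graftSym (rootLabel τ)).lTensor (ForestAlg d) (coprod (ofForest (branches τ)))
    | .noise ζ i => (mulXi i).lTensor (ForestAlg d) (coprod (ofForest ζ))

theorem toForestAlg_coaction_tree (τ : Tree d) :
    toForestAlg.lTensor (ForestAlg d) (coaction (Finsupp.single (.tree τ) 1)) =
      coprod (ofForest {τ}) := by
  have h : toForestAlg ∘ₗ graftSym (rootLabel τ) = graft (rootLabel τ) := by
    ext ζ
    simp [toForestAlg, graftSym, graft, linExt]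
  rw [coprod_ofForest, Multiset.map_singleton, Multiset.prod_singleton]
  conv_rhs => rw [← node_rootLabel_branches τ, coprodTree_node, node_rootLabel_branches, ← h]
  simp [coaction, LinearMap.lTensor_comp, toForestAlg]

/-- The action `(g ⊗ id) Δ^b` of a character `g` of the forest algebra. -/
def structAction (g : ForestAlg d →ₐ[ℝ] ℝ) : ModelSpace d →ₗ[ℝ] ModelSpace d :=
  (TensorProduct.lid ℝ (ModelSpace d)).toLinearMap ∘ₗ
    g.toLinearMap.rTensor (ModelSpace d) ∘ₗ coaction

/-- The structure group of the branched rough path regularity structure. -/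
def structureGroup (d : ℕ) : Set (ModelSpace d →ₗ[ℝ] ModelSpace d) := Set.range structAction

/-- The set of models on `ℝ` for the branched rough path regularity structure. -/
abbrev BranchedModel (d : ℕ) (γ : ℝ) : Type :=
  Model (homogeneity (d := d) γ) (structureGroup d)

/-- The coefficient `y^𝟏` of the unit symbol. -/
def unitCoeff (y : ModelSpace d) : ℝ := y .unit

/-- The value `∑_{n ≤ ⌊α/γ⌋} π_{<α+γ-1} (f⁽ⁿ⁾(y^𝟏)/n!) (y - y^𝟏 𝟏)^{⊙n} Ξ_i`. -/
def taylorLift (γ α : ℝ) (f : ℝ → ℝ) (i : Fin d) (y : ModelSpace d) : ModelSpace d :=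
  ∑ n ∈ Finset.range (⌊α / γ⌋₊ + 1),
    projBelow (homogeneity γ) (α + γ - 1)
      ((iteratedDeriv n f (unitCoeff y) / (n.factorial : ℝ)) •
        mulXi i (toForestAlg (y - Finsupp.single .unit (unitCoeff y)) ^ n))

end Branched

end

end BranchedRS

/-! ### Taylor sums in commutative algebras -/

namespace BranchedRS

/-! Identify ⟨𝒴⟩ with the span of 𝟏 and the single trees in the commutative algebra ⟨F_d⟩. The
action of a character g then becomes the algebra morphism A = (g ⊗ id)Δ (`charAction`), compatible
with `toForestAlg` and `mulXi`, so A commutes with powers and Taylor sums. Put P = ⌈α/γ⌉. Since γ|ζ|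
< α iff |ζ| < P, cutting in homogeneity is cutting in the number of vertices, and the lift is Ξ_i
times the truncation of ∑_{n<P} f⁽ⁿ⁾(Y^𝟏)/n! (Y - Y^𝟏)ⁿ (`taylorLift_eq`).

For h = |t - s| ≤ 1 and r = h^γ, consider p(x) = ∑_{|ζ|<P} r^|ζ| |x_ζ| (`truncNorm`). This seminorm
is submultiplicative, and up to constants the increment bound of order α for Y says p(Y(t) - A Y(s))
≲ h^α. The model bounds give p(Aζ) ≲ r^|ζ| (`exists_scaledBound`). That f(Y) is again modelled is
then Taylor's theorem: changing the base point of the expansion costs κ^P ≤ h^α with κ = max(h^γ,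
h^α), by `seminorm_taylorSum_sub_le`.

For the Lipschitz bound, differentiate along the segment G + θ(F - G). Modulo forests with at least
P vertices the derivative is f'(G + θ(F - G)) · (F - G), a product whose modelled distribution
bounds are linear in the size of F - G (`exists_truncNorm_compose_mul_sub_le`). The mean value
inequality (`abs_sub_le_of_compose`) integrates this. The argument uses P derivatives of f', whence
k ≥ α/γ + 1. Continuity and finiteness of the norms follow from the Lipschitz bound. -/

theorem abs_sub_taylor_le {D B : ℝ} (M : ℕ) : ∀ (g : ℝ → ℝ), ContDiff ℝ M g →
    (∀ x, |x| ≤ D → |iteratedDeriv M g x| ≤ B) → ∀ a b, |a| ≤ D → |b| ≤ D →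
    |g b - ∑ n ∈ Finset.range M, iteratedDeriv n g a / (n.factorial : ℝ) * (b - a) ^ n| ≤
      B * |b - a| ^ M := by
  induction M with
  | zero =>
    intro g _ hB a b _ hb
    simpa using hB b hb
  | succ M ih =>
    intro g hg hB a b ha hb
    have hg' : ContDiff ℝ M (deriv g) := by
      have : ContDiff ℝ ((M : WithTop ℕ∞) + 1) g := by exact_mod_cast hg
      exact (contDiff_succ_iff_deriv.1 this).2.2
    have hgd : Differentiable ℝ g := hg.differentiable (by simp)
    set φ : ℝ → ℝ := fun x =>
      g x - ∑ n ∈ Finset.range (M + 1), iteratedDeriv n g a / (n.factorial : ℝ) * (x - a) ^ n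
      with hφ
    -- The derivative in x of the remainder of g is the remainder of `deriv g` one order lower, so
    -- the induction hypothesis bounds it and the mean value inequality adds the missing power of |b
    -- - a|. The factor 1/M! is given away.
    have hder : ∀ x, HasDerivAt φ (deriv g x - ∑ n ∈ Finset.range M,
        iteratedDeriv n (deriv g) a / (n.factorial : ℝ) * (x - a) ^ n) x := by
      intro x
      refine (hgd x).hasDerivAt.sub ?_
      have h : ∀ n ∈ Finset.range (M + 1), HasDerivAt
          (fun x => iteratedDeriv n g a / (n.factorial : ℝ) * (x - a) ^ n)
          (iteratedDeriv n g a / (n.factorial : ℝ) * (n * (x - a) ^ (n - 1))) x := by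
        intro n _
        have := ((hasDerivAt_id x).sub_const a).pow n
        simpa using this.const_mul (iteratedDeriv n g a / (n.factorial : ℝ))
      have h2 := HasDerivAt.fun_sum h
      rw [Finset.sum_range_succ'] at h2
      convert h2 using 1
      simp only [CharP.cast_eq_zero, zero_mul, mul_zero, add_zero]
      refine Finset.sum_congr rfl fun n _ => ?_
      rw [iteratedDeriv_succ', Nat.factorial_succ]
      have : (n.factorial : ℝ) ≠ 0 := by positivity
      have : ((n + 1 : ℕ) : ℝ) ≠ 0 := by positivity
      rw [Nat.add_sub_cancel]
      push_cast at *
      field_simp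
    have hbd : ∀ x ∈ Set.uIcc a b, ‖deriv g x - ∑ n ∈ Finset.range M,
        iteratedDeriv n (deriv g) a / (n.factorial : ℝ) * (x - a) ^ n‖ ≤ B * |b - a| ^ M := by
      intro x hx
      have hxD : |x| ≤ D := by
        have h1 : a ∈ Set.Icc (-D) D := abs_le.1 ha
        have h2 : b ∈ Set.Icc (-D) D := abs_le.1 hb
        exact abs_le.2 (Set.uIcc_subset_Icc h1 h2 hx)
      have hB0 : 0 ≤ B := (abs_nonneg _).trans (hB a ha)
      refine (ih (deriv g) hg' ?_ a x ha hxD).trans ?_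
      · intro y hy
        rw [← iteratedDeriv_succ']
        exact hB y hy
      · have : |x - a| ≤ |b - a| := Set.abs_sub_left_of_mem_uIcc hx
        gcongr
    have hmv := (convex_uIcc a b).norm_image_sub_le_of_norm_hasDerivWithin_le
      (fun x _ => (hder x).hasDerivWithinAt) hbd Set.left_mem_uIcc Set.right_mem_uIcc
    have h0 : φ a = 0 := by
      simp only [hφ, Finset.sum_range_succ']
      simp
    rw [h0, sub_zero] at hmv
    simpa [pow_succ, mul_assoc] using hmv

theorem iteratedDeriv_add_eq (n j : ℕ) (g : ℝ → ℝ) :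
    iteratedDeriv (n + j) g = iteratedDeriv n (iteratedDeriv j g) := by
  simp only [iteratedDeriv_eq_iterate, Function.iterate_add_apply]

section Algebra

variable {H : Type*} [CommRing H] [Algebra ℝ H]

/-- The sum `∑_{n < P} g⁽ⁿ⁾(a)/n! xⁿ` in a commutative algebra. -/
noncomputable def taylorSum (g : ℝ → ℝ) (P : ℕ) (a : ℝ) (x : H) : H :=
  ∑ n ∈ Finset.range P, (iteratedDeriv n g a / (n.factorial : ℝ)) • x ^ n

theorem map_taylorSum {H' : Type*} [CommRing H'] [Algebra ℝ H'] (φ : H →ₐ[ℝ] H') (g : ℝ → ℝ)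
    (P : ℕ) (a : ℝ) (x : H) : φ (taylorSum g P a x) = taylorSum g P a (φ x) := by
  simp [taylorSum]

/-- Binomial expansion followed by an exchange of the two sums: the coefficient of z^j is itself the
Taylor polynomial of g⁽ʲ⁾ with P - j terms, to which the scalar Taylor theorem applies. -/
theorem taylorSum_add_smul_one (g : ℝ → ℝ) (P : ℕ) (a c : ℝ) (z : H) :
    taylorSum g P a (z + c • 1) = ∑ j ∈ Finset.range P,
      ((∑ n ∈ Finset.range (P - j), iteratedDeriv n (iteratedDeriv j g) a / (n.factorial : ℝ) *
        c ^ n) / (j.factorial : ℝ)) • z ^ j := by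
  have h := Finset.sum_range_diag_flip P fun j n =>
    ((iteratedDeriv (n + j) g a / (n.factorial : ℝ) * c ^ n) / (j.factorial : ℝ)) • z ^ j
  simp only [taylorSum]
  refine Eq.trans (Finset.sum_congr rfl fun m _ => ?_) (h.trans (Finset.sum_congr rfl fun j _ => ?_))
  · rw [add_pow, Finset.smul_sum]
    refine Finset.sum_congr rfl fun j hj => ?_
    have hjm : j ≤ m := Nat.lt_succ_iff.1 (Finset.mem_range.1 hj)
    have h1 : ((m.choose j : ℕ) : ℝ) = m.factorial / (j.factorial * (m - j).factorial) :=
      Nat.cast_choose ℝ hjm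
    have h2 : ((m.choose j : ℕ) : H) = ((m.choose j : ℕ) : ℝ) • (1 : H) := by
      rw [Nat.cast_smul_eq_nsmul, nsmul_eq_mul, mul_one]
    rw [Nat.sub_add_cancel hjm, h2, smul_pow, one_pow, h1]
    simp only [mul_smul_comm, mul_one, smul_smul]
    congr 1
    have : (m.factorial : ℝ) ≠ 0 := by positivity
    field_simp
  · rw [Finset.sum_div, Finset.sum_smul]
    refine Finset.sum_congr rfl fun n _ => ?_
    rw [iteratedDeriv_add_eq]

/-! ### Estimates in submultiplicative seminorms -/

theorem seminorm_sum_le (p : Seminorm ℝ H) {ι : Type*} (s : Finset ι) (x : ι → H) :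
    p (∑ j ∈ s, x j) ≤ ∑ j ∈ s, p (x j) :=
  Finset.le_sum_of_subadditive p (map_zero p).le (map_add_le_add p) s x

theorem seminorm_pow_le {p : Seminorm ℝ H} (hmul : ∀ x y, p (x * y) ≤ p x * p y) (h1 : p 1 ≤ 1)
    {x : H} {M : ℝ} (hx : p x ≤ M) (n : ℕ) : p (x ^ n) ≤ M ^ n := by
  induction n with
  | zero => simpa using h1
  | succ n ih =>
    rw [pow_succ, pow_succ]
    have := (apply_nonneg p x).trans hx
    exact (hmul _ _).trans (mul_le_mul ih hx (apply_nonneg _ _) (by positivity))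

theorem seminorm_pow_sub_pow_le {p : Seminorm ℝ H} (hmul : ∀ x y, p (x * y) ≤ p x * p y)
    (h1 : p 1 ≤ 1) {x y : H} {M : ℝ} (hM : 1 ≤ M) (hx : p x ≤ M) (hy : p y ≤ M) (n : ℕ) :
    p (x ^ n - y ^ n) ≤ n * M ^ n * p (x - y) := by
  induction n with
  | zero => simp
  | succ n ih =>
    have h : x ^ (n + 1) - y ^ (n + 1) = x * (x ^ n - y ^ n) + (x - y) * y ^ n := by ring
    rw [h]
    have hq := apply_nonneg p (x - y)
    calc _ ≤ p (x * (x ^ n - y ^ n)) + p ((x - y) * y ^ n) := map_add_le_add _ _ _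
      _ ≤ p x * p (x ^ n - y ^ n) + p (x - y) * p (y ^ n) := add_le_add (hmul _ _) (hmul _ _)
      _ ≤ M * (n * M ^ n * p (x - y)) + p (x - y) * M ^ n := by
          gcongr
          exact seminorm_pow_le hmul h1 hy n
      _ ≤ M * (n * M ^ n * p (x - y)) + p (x - y) * M ^ (n + 1) := by
          gcongr
          omega
      _ = _ := by push_cast; ring

theorem div_factorial_abs_le {x B : ℝ} (h : |x| ≤ B) (n : ℕ) : |x / (n.factorial : ℝ)| ≤ B := by
  rw [abs_div, Nat.abs_cast]
  refine (div_le_self (abs_nonneg _) ?_).trans h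
  exact_mod_cast n.factorial_pos

theorem seminorm_taylorSum_le {p : Seminorm ℝ H} (hmul : ∀ x y, p (x * y) ≤ p x * p y)
    (h1 : p 1 ≤ 1) {g : ℝ → ℝ} {P : ℕ} {B M : ℝ} {a : ℝ} {x : H} (hM : 1 ≤ M) (hx : p x ≤ M)
    (hB : ∀ n ≤ P, |iteratedDeriv n g a| ≤ B) : p (taylorSum g P a x) ≤ P * (B * M ^ P) := by
  have hB0 : 0 ≤ B := (abs_nonneg _).trans (hB 0 P.zero_le)
  refine (seminorm_sum_le p _ _).trans ?_
  refine (Finset.sum_le_card_nsmul _ _ (B * M ^ P) fun n hn => ?_).trans (by simp)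
  have hn' := (Finset.mem_range.1 hn).le
  rw [map_smul_eq_mul, Real.norm_eq_abs]
  gcongr
  · exact div_factorial_abs_le (hB n hn') n
  · exact (seminorm_pow_le hmul h1 hx n).trans (pow_le_pow_right₀ hM hn')

/-- Stability of Taylor sums: if `x = z + (b - a) + R` with `z` and `b - a` of order `κ` and `R` of
order `ρ ≥ κ ^ P`, then the Taylor sums of `g` at `a` and `b` differ by a term of order `ρ`. -/
theorem seminorm_taylorSum_sub_le {p : Seminorm ℝ H} (hmul : ∀ x y, p (x * y) ≤ p x * p y)
    (h1 : p 1 ≤ 1) {g : ℝ → ℝ} {P : ℕ} (hg : ContDiff ℝ P g) {B C D : ℝ} (hC : 1 ≤ C)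
    (hB : ∀ n ≤ P, ∀ x, |x| ≤ D → |iteratedDeriv n g x| ≤ B) {a b : ℝ} (ha : |a| ≤ D)
    (hb : |b| ≤ D) {κ ρ : ℝ} (hκ : 0 ≤ κ) (hκ1 : κ ≤ 1) (hκρ : κ ^ P ≤ ρ) (hρ1 : ρ ≤ 1)
    {x z R : H} (hx : x = z + (b - a) • 1 + R) (hz : p z ≤ C * κ) (hba : |b - a| ≤ C * κ)
    (hR : p R ≤ C * ρ) :
    p (taylorSum g P a x - taylorSum g P b z) ≤
      (P * (B * (P * (3 * C) ^ P * C)) + P * (B * C ^ P)) * ρ := by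
  have hB0 : 0 ≤ B := (abs_nonneg _).trans (hB 0 P.zero_le a ha)
  have hρ0 : 0 ≤ ρ := (pow_nonneg hκ P).trans hκρ
  have hc1 : p ((b - a) • (1 : H)) ≤ C := by
    rw [map_smul_eq_mul, Real.norm_eq_abs]
    have := mul_le_mul (hba.trans (mul_le_of_le_one_right (by linarith) hκ1)) h1
      (apply_nonneg _ _) (by linarith)
    simpa using this
  have hzC : p z ≤ C := hz.trans (mul_le_of_le_one_right (by linarith) hκ1)
  have hRC : p R ≤ C := hR.trans (mul_le_of_le_one_right (by linarith) hρ1)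
  have hu : p (z + (b - a) • 1) ≤ 3 * C := (map_add_le_add _ _ _).trans (by linarith)
  have hxM : p x ≤ 3 * C := by
    rw [hx]
    refine (map_add_le_add _ _ _).trans ?_
    have := (map_add_le_add p z ((b - a) • 1))
    linarith
  -- Discarding R changes each power by a multiple of p R, with a factor bounded through 3C, since
  -- z, (b - a) • 1 and R each have size at most C.
  have hfirst : p (taylorSum g P a x - taylorSum g P a (z + (b - a) • 1)) ≤
      P * (B * (P * (3 * C) ^ P * (C * ρ))) := by
    unfold taylorSum
    rw [← Finset.sum_sub_distrib]
    refine (seminorm_sum_le p _ _).trans ?_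
    refine (Finset.sum_le_card_nsmul _ _ (B * (P * (3 * C) ^ P * (C * ρ)))
      fun n hn => ?_).trans (by simp)
    have hn' := (Finset.mem_range.1 hn).le
    rw [← smul_sub, map_smul_eq_mul, Real.norm_eq_abs]
    have hd : x - (z + (b - a) • 1) = R := by rw [hx]; abel
    have := seminorm_pow_sub_pow_le hmul h1 (by linarith : 1 ≤ 3 * C) hxM hu n
    rw [hd] at this
    refine mul_le_mul (div_factorial_abs_le (hB n hn' a ha) n) (this.trans ?_)
      (apply_nonneg _ _) hB0
    gcongr
    linarith
  -- In the coefficient of z^j the Taylor error is of order κ^(P-j), and z^j supplies the remaining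
  -- κ^j, so every term is of order κ^P ≤ ρ.
  have hsecond : p (taylorSum g P a (z + (b - a) • 1) - taylorSum g P b z) ≤
      P * (B * (C ^ P * ρ)) := by
    rw [taylorSum_add_smul_one, taylorSum, ← Finset.sum_sub_distrib]
    refine (seminorm_sum_le p _ _).trans ?_
    refine (Finset.sum_le_card_nsmul _ _ (B * (C ^ P * ρ)) fun j hj => ?_).trans (by simp)
    have hj' := (Finset.mem_range.1 hj).le
    rw [← sub_smul, ← sub_div, map_smul_eq_mul, Real.norm_eq_abs]
    have hT := abs_sub_taylor_le (D := D) (B := B) (P - j) (iteratedDeriv j g) (by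
        rw [iteratedDeriv_eq_iterate]
        exact ContDiff.iterate_deriv' (P - j) j (by rwa [Nat.sub_add_cancel hj'])) (by
        intro x hx
        rw [← iteratedDeriv_add_eq, Nat.sub_add_cancel hj']
        exact hB P le_rfl x hx) a b ha hb
    rw [abs_sub_comm] at hT
    calc _ ≤ (B * (C * κ) ^ (P - j)) * (C * κ) ^ j :=
          mul_le_mul (div_factorial_abs_le (hT.trans (by gcongr)) j)
            (seminorm_pow_le hmul h1 hz j) (apply_nonneg _ _) (by positivity)
      _ = B * (C ^ P * κ ^ P) := by
          rw [mul_assoc, ← pow_add, Nat.sub_add_cancel hj', mul_pow]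
      _ ≤ _ := by gcongr
  have hsum : taylorSum g P a x - taylorSum g P b z =
      (taylorSum g P a x - taylorSum g P a (z + (b - a) • 1)) +
      (taylorSum g P a (z + (b - a) • 1) - taylorSum g P b z) := by abel
  rw [hsum]
  refine (map_add_le_add _ _ _).trans ((add_le_add hfirst hsecond).trans (le_of_eq (by ring)))

/-- Testing against ℓ avoids any topology on H: the function is a real polynomial in θ. The
induction runs over all ℓ at once because splitting off a factor U + θV replaces ℓ by its
compositions with multiplication by U and by V. -/
theorem hasDerivAt_linear_pow (U V : H) (n : ℕ) : ∀ (ℓ : H →ₗ[ℝ] ℝ) (θ : ℝ),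
    HasDerivAt (fun θ : ℝ => ℓ ((U + θ • V) ^ n)) (n * ℓ ((U + θ • V) ^ (n - 1) * V)) θ := by
  induction n with
  | zero => intro ℓ θ; simpa using hasDerivAt_const θ (ℓ 1)
  | succ n ih =>
    intro ℓ θ
    have h1 := ih (ℓ ∘ₗ LinearMap.mulLeft ℝ U) θ
    have h2 := (hasDerivAt_id θ).mul (ih (ℓ ∘ₗ LinearMap.mulLeft ℝ V) θ)
    have hfun : (fun θ : ℝ => ℓ ((U + θ • V) ^ (n + 1))) =
        (fun θ => (ℓ ∘ₗ LinearMap.mulLeft ℝ U) ((U + θ • V) ^ n)) +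
          id * fun θ => (ℓ ∘ₗ LinearMap.mulLeft ℝ V) ((U + θ • V) ^ n) := by
      funext θ
      simp only [LinearMap.comp_apply, LinearMap.mulLeft_apply, id, Pi.add_apply, Pi.mul_apply]
      rw [pow_succ', add_mul, map_add, smul_mul_assoc, map_smul, smul_eq_mul]
    rw [hfun]
    refine (h1.add h2).congr_deriv ?_
    · simp only [LinearMap.comp_apply, LinearMap.mulLeft_apply, id]
      rcases n with _ | n
      · simp
      · have : (U + θ • V) ^ (n + 1) * V = U * ((U + θ • V) ^ n * V) +
            θ • (V * ((U + θ • V) ^ n * V)) := by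
          rw [pow_succ', mul_assoc, add_mul, smul_mul_assoc]
        simp only [Nat.add_sub_cancel]
        rw [this, mul_comm V ((U + θ • V) ^ (n + 1)), this]
        simp only [map_add, map_smul, smul_eq_mul]
        push_cast
        ring

/-- The derivative of a Taylor sum along a line, tested against a functional that does not see the
top order term. -/
theorem hasDerivAt_taylorSum {f : ℝ → ℝ} {P : ℕ} (hf : ContDiff ℝ P f) (y v : ℝ) (U V : H)
    (ℓ : H →ₗ[ℝ] ℝ) (θ : ℝ) (hℓ : ℓ ((U + θ • V) ^ (P - 1) * V) = 0) :
    HasDerivAt (fun θ : ℝ => ℓ (taylorSum f P (y + θ * v) (U + θ • V)))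
      (ℓ (taylorSum (deriv f) P (y + θ * v) (U + θ • V) * (v • 1 + V))) θ := by
  have hterm : ∀ n ∈ Finset.range P, HasDerivAt
      (fun θ : ℝ => iteratedDeriv n f (y + θ * v) / (n.factorial : ℝ) * ℓ ((U + θ • V) ^ n))
      (iteratedDeriv n (deriv f) (y + θ * v) * v / (n.factorial : ℝ) * ℓ ((U + θ • V) ^ n) +
        iteratedDeriv n f (y + θ * v) / (n.factorial : ℝ) *
          (n * ℓ ((U + θ • V) ^ (n - 1) * V))) θ := by
    intro n hn
    have hd : HasDerivAt (iteratedDeriv n f) (iteratedDeriv n (deriv f) (y + θ * v))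
        (y + θ * v) := by
      rw [← iteratedDeriv_succ', iteratedDeriv_succ]
      exact ((hf.differentiable_iteratedDeriv n
        (by exact_mod_cast Finset.mem_range.1 hn)) _).hasDerivAt
    have hl : HasDerivAt (fun θ : ℝ => y + θ * v) v θ := by
      simpa using ((hasDerivAt_id θ).mul_const v).const_add y
    exact ((hd.comp θ hl).div_const _).mul (hasDerivAt_linear_pow U V n ℓ θ)
  have hsum := HasDerivAt.fun_sum hterm
  have hfun : (fun θ : ℝ => ℓ (taylorSum f P (y + θ * v) (U + θ • V))) = fun θ =>
      ∑ n ∈ Finset.range P,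
        iteratedDeriv n f (y + θ * v) / (n.factorial : ℝ) * ℓ ((U + θ • V) ^ n) := by
    funext θ
    simp [taylorSum]
  rw [hfun]
  refine hsum.congr_deriv (Eq.symm ?_)
  · rw [Finset.sum_add_distrib, mul_add, map_add]
    congr 1
    · simp only [taylorSum, mul_smul_comm, mul_one, map_smul, map_sum, smul_eq_mul, Finset.mul_sum]
      refine Finset.sum_congr rfl fun n _ => by ring
    · simp only [taylorSum, Finset.sum_mul, smul_mul_assoc, map_smul, map_sum, smul_eq_mul]
      rcases P with _ | P
      · simp
      -- After the shift n ↦ n + 1 the two sums agree except for the top term (U + θV)^(P-1) V,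
      -- which ℓ annihilates.
      · rw [Finset.sum_range_succ, Finset.sum_range_succ']
        simp only [Nat.add_sub_cancel] at hℓ
        rw [hℓ]
        simp only [mul_zero, add_zero, CharP.cast_eq_zero, zero_mul]
        refine Finset.sum_congr rfl fun n _ => ?_
        rw [iteratedDeriv_succ', Nat.factorial_succ, Nat.add_sub_cancel]
        have : (n.factorial : ℝ) ≠ 0 := by positivity
        push_cast
        field_simp

end Algebra

end BranchedRS

/-! ### Weighted `ℓ¹` seminorms on monoid algebras -/

namespace BranchedRS

section Weighted

variable {M : Type*} [AddCommMonoid M]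

/-- The weighted `ℓ¹` seminorm `∑ w(m) |x_m|` on a monoid algebra. -/
noncomputable def weightSeminorm (w : M → ℝ) (hw : ∀ m, 0 ≤ w m) :
    Seminorm ℝ (AddMonoidAlgebra ℝ M) :=
  Seminorm.of (fun x => x.coeff.sum fun m c => |c| * w m)
    (fun x y => by
      classical
      have h : ∀ z : M →₀ ℝ, z.support ⊆ x.coeff.support ∪ y.coeff.support →
          (z.sum fun m c => |c| * w m) =
            ∑ m ∈ x.coeff.support ∪ y.coeff.support, |z m| * w m := fun z hz =>
        Finsupp.sum_of_support_subset _ hz _ (by simp)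
      rw [AddMonoidAlgebra.coeff_add, h _ Finsupp.support_add, h _ Finset.subset_union_left,
        h _ Finset.subset_union_right, ← Finset.sum_add_distrib]
      refine Finset.sum_le_sum fun m _ => ?_
      rw [← add_mul, Finsupp.add_apply]
      exact mul_le_mul_of_nonneg_right (abs_add_le _ _) (hw m))
    (fun a x => by
      rw [AddMonoidAlgebra.coeff_smul, Finsupp.sum_of_support_subset _ Finsupp.support_smul _
        (by simp), Finsupp.sum, Finset.mul_sum]
      refine Finset.sum_congr rfl fun m _ => ?_
      simp [abs_mul, mul_assoc])

variable {w : M → ℝ} {hw : ∀ m, 0 ≤ w m}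

theorem weightSeminorm_apply (x : AddMonoidAlgebra ℝ M) :
    weightSeminorm w hw x = x.coeff.sum fun m c => |c| * w m := rfl

theorem weightSeminorm_single (m : M) (c : ℝ) :
    weightSeminorm w hw (AddMonoidAlgebra.single m c) = |c| * w m := by
  rw [weightSeminorm_apply, AddMonoidAlgebra.coeff_single, Finsupp.sum_single_index (by simp)]

theorem weightSeminorm_le_sum (x : AddMonoidAlgebra ℝ M) (s : Finset M)
    (hs : ∀ m ∉ s, x.coeff m = 0 ∨ w m = 0) :
    weightSeminorm w hw x ≤ ∑ m ∈ s, |x.coeff m| * w m := by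
  classical
  rw [weightSeminorm_apply, Finsupp.sum_of_support_subset (s := x.coeff.support ∪ s) _
    Finset.subset_union_left _ (by simp)]
  refine (Finset.sum_subset Finset.subset_union_right fun m _ hm => ?_).ge
  rcases hs m hm with h | h <;> simp [h]

/-- By the triangle inequality an ℓ¹ bound needs checking on basis elements only. Only those in the
support of x matter, which is how bounds on the number of vertices enter later. -/
theorem seminorm_linearMap_le {N : Type*} [AddCommGroup N] [Module ℝ N] (q : Seminorm ℝ N)
    (φ : AddMonoidAlgebra ℝ M →ₗ[ℝ] N) (x : AddMonoidAlgebra ℝ M) {C : ℝ}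
    (h : ∀ m ∈ x.coeff.support, q (φ (AddMonoidAlgebra.single m 1)) ≤ C * w m) :
    q (φ x) ≤ C * weightSeminorm w hw x := by
  have hx : x = ∑ m ∈ x.coeff.support, x.coeff m • AddMonoidAlgebra.single m (1 : ℝ) := by
    conv_lhs => rw [← AddMonoidAlgebra.sum_coeff_single x]
    exact Finset.sum_congr rfl fun m _ => by simp
  conv_lhs => rw [hx]
  rw [map_sum]
  refine (Finset.le_sum_of_subadditive q (map_zero q).le (map_add_le_add q) _ _).trans ?_
  rw [weightSeminorm_apply, Finsupp.sum, Finset.mul_sum]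
  refine Finset.sum_le_sum fun m hm => ?_
  rw [map_smul, map_smul_eq_mul, Real.norm_eq_abs, mul_left_comm]
  exact mul_le_mul_of_nonneg_left (h m hm) (abs_nonneg _)

/-- The product is bilinear, so the reduction to basis elements is applied once in each factor. -/
theorem weightSeminorm_mul_le (hmul : ∀ m n, w (m + n) ≤ w m * w n)
    (x y : AddMonoidAlgebra ℝ M) :
    weightSeminorm w hw (x * y) ≤ weightSeminorm w hw x * weightSeminorm w hw y := by
  rw [mul_comm (weightSeminorm w hw x)]
  refine seminorm_linearMap_le (hw := hw) (weightSeminorm w hw) (LinearMap.mulRight ℝ y) x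
    fun m _ => ?_
  rw [LinearMap.mulRight_apply, mul_comm _ (w m)]
  refine seminorm_linearMap_le (hw := hw) (weightSeminorm w hw)
    (LinearMap.mulLeft ℝ (AddMonoidAlgebra.single m (1 : ℝ))) y fun n _ => ?_
  rw [LinearMap.mulLeft_apply, AddMonoidAlgebra.single_mul_single, weightSeminorm_single]
  simpa using hmul m n

theorem mul_mem_supported {S T U : Set M} (h : ∀ m ∈ S, ∀ n ∈ T, m + n ∈ U)
    {x y : AddMonoidAlgebra ℝ M} (hx : x ∈ AddMonoidAlgebra.supported ℝ ℝ S)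
    (hy : y ∈ AddMonoidAlgebra.supported ℝ ℝ T) :
    x * y ∈ AddMonoidAlgebra.supported ℝ ℝ U := by
  classical
  rw [AddMonoidAlgebra.mem_supported] at *
  intro k hk
  obtain ⟨m, hm, n, hn, rfl⟩ := Finset.mem_add.1 (AddMonoidAlgebra.support_coeff_mul_subset _ _ hk)
  exact h m (hx hm) n (hy hn)

omit [AddCommMonoid M] in
theorem single_mem_supported {S : Set M} {m : M} (hm : m ∈ S) (c : ℝ) :
    AddMonoidAlgebra.single m c ∈ AddMonoidAlgebra.supported ℝ ℝ S := by
  rw [AddMonoidAlgebra.mem_supported, AddMonoidAlgebra.coeff_single]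
  intro k hk
  rwa [Finset.mem_singleton.1 (Finsupp.support_single_subset hk)]

end Weighted

/-! ### Sizes of forests -/

section Forests

variable {d : ℕ}

theorem forestSize_zero : forestSize (0 : Forest d) = 0 := rfl

theorem forestSize_add (ζ ξ : Forest d) : forestSize (ζ + ξ) = forestSize ζ + forestSize ξ := by
  simp [forestSize]

theorem forestSize_singleton (τ : Tree d) : forestSize {τ} = τ.size := by
  simp [forestSize]

theorem Tree.size_pos (τ : Tree d) : 0 < τ.size := by
  rw [← node_rootLabel_branches τ, size_node]
  exact Nat.succ_pos _

theorem Tree.size_le_forestSize {τ : Tree d} {ζ : Forest d} (h : τ ∈ ζ) :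
    τ.size ≤ forestSize ζ := by
  obtain ⟨ξ, rfl⟩ := Multiset.exists_cons_of_mem h
  simp [forestSize]

theorem card_le_forestSize (ζ : Forest d) : Multiset.card ζ ≤ forestSize ζ := by
  induction ζ using Multiset.induction with
  | empty => simp
  | cons τ ζ ih =>
    rw [← Multiset.singleton_add, forestSize_add, forestSize_singleton, Multiset.card_add]
    have := τ.size_pos
    simp only [Multiset.card_singleton]
    omega

theorem finite_forestSize_lt (n : ℕ) : {ζ : Forest d | forestSize ζ < n}.Finite := by
  classical
  induction n with
  | zero => simp
  | succ n ih =>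
    have htree : {τ : Tree d | τ.size < n + 1}.Finite := by
      refine ((Set.finite_univ (α := Fin d)).prod ih |>.image fun p => node p.1 p.2).subset ?_
      intro τ hτ
      refine ⟨(rootLabel τ, branches τ), ⟨Set.mem_univ _, ?_⟩, node_rootLabel_branches τ⟩
      have : τ.size < n + 1 := hτ
      rw [← node_rootLabel_branches τ, size_node] at this
      simpa using this
    -- At most n vertices means at most n trees, each with at most n vertices; such a forest lies
    -- below n copies of the finite set of those trees.
    refine (Set.finite_Iic (n • htree.toFinset.val)).subset fun ζ hζ => ?_
    have hζ' : forestSize ζ < n + 1 := hζ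
    rw [Set.mem_Iic, Multiset.le_iff_count]
    intro τ
    by_cases hτ : τ ∈ ζ
    · have hmem : τ ∈ htree.toFinset := by
        rw [Set.Finite.mem_toFinset]
        exact (Tree.size_le_forestSize hτ).trans_lt hζ'
      rw [Multiset.count_nsmul, Multiset.count_eq_one_of_mem htree.toFinset.nodup hmem]
      have := (Multiset.count_le_card τ ζ).trans (card_le_forestSize ζ)
      omega
    · rw [Multiset.count_eq_zero_of_notMem hτ]
      exact Nat.zero_le _

/-- The finite set of forests with less than `n` vertices. -/
noncomputable def smallForests (d n : ℕ) : Finset (Forest d) :=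
  (finite_forestSize_lt (d := d) n).toFinset

theorem mem_smallForests {n : ℕ} {ζ : Forest d} : ζ ∈ smallForests d n ↔ forestSize ζ < n := by
  simp [smallForests]

/-- Linear combinations of forests with at least `n` vertices. -/
noncomputable def sizeGE (d n : ℕ) : Submodule ℝ (ForestAlg d) :=
  AddMonoidAlgebra.supported ℝ ℝ {ζ | n ≤ forestSize ζ}

/-- Linear combinations of forests with less than `n` vertices. -/
noncomputable def sizeLT (d n : ℕ) : Submodule ℝ (ForestAlg d) :=
  AddMonoidAlgebra.supported ℝ ℝ {ζ | forestSize ζ < n}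

/-- Linear combinations of forests with at most `n` vertices. -/
noncomputable def sizeLE (d n : ℕ) : Submodule ℝ (ForestAlg d) :=
  AddMonoidAlgebra.supported ℝ ℝ {ζ | forestSize ζ ≤ n}

theorem mul_mem_sizeGE {m n : ℕ} {x y : ForestAlg d} (hx : x ∈ sizeGE d m) (hy : y ∈ sizeGE d n) :
    x * y ∈ sizeGE d (m + n) :=
  mul_mem_supported (fun ζ hζ ξ hξ => by
    simp only [Set.mem_ofPred_eq, forestSize_add] at *; omega) hx hy

theorem mul_mem_sizeLE {m n : ℕ} {x y : ForestAlg d} (hx : x ∈ sizeLE d m) (hy : y ∈ sizeLE d n) :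
    x * y ∈ sizeLE d (m + n) :=
  mul_mem_supported (fun ζ hζ ξ hξ => by
    simp only [Set.mem_ofPred_eq, forestSize_add] at *; omega) hx hy

theorem one_mem_sizeGE : (1 : ForestAlg d) ∈ sizeGE d 0 :=
  single_mem_supported (by simp) 1

theorem one_mem_sizeLE : (1 : ForestAlg d) ∈ sizeLE d 0 :=
  single_mem_supported (by simp [forestSize_zero]) 1

theorem pow_mem_sizeGE {x : ForestAlg d} (hx : x ∈ sizeGE d 1) (n : ℕ) : x ^ n ∈ sizeGE d n := by
  induction n with
  | zero => simpa using one_mem_sizeGE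
  | succ n ih => rw [pow_succ]; exact mul_mem_sizeGE ih hx

theorem pow_mem_sizeLE {m : ℕ} {x : ForestAlg d} (hx : x ∈ sizeLE d m) (n : ℕ) :
    x ^ n ∈ sizeLE d (n * m) := by
  induction n with
  | zero => simpa using one_mem_sizeLE
  | succ n ih => rw [pow_succ, add_mul, one_mul]; exact mul_mem_sizeLE ih hx

theorem sizeLE_mono {m n : ℕ} (h : m ≤ n) : sizeLE d m ≤ sizeLE d n :=
  AddMonoidAlgebra.supported_mono fun _ hζ => le_trans (α := ℕ) hζ h

theorem sizeGE_anti {m n : ℕ} (h : m ≤ n) : sizeGE d n ≤ sizeGE d m :=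
  AddMonoidAlgebra.supported_mono fun _ hζ => le_trans (α := ℕ) h hζ

theorem coeff_eq_zero_of_mem_sizeGE {n : ℕ} {x : ForestAlg d} (hx : x ∈ sizeGE d n)
    {ζ : Forest d} (hζ : forestSize ζ < n) : x.coeff ζ = 0 :=
  AddMonoidAlgebra.mem_supported'.1 hx ζ (by simpa using hζ)

theorem taylorSum_mem_sizeLE {m : ℕ} {x : ForestAlg d} (hx : x ∈ sizeLE d m) (g : ℝ → ℝ) (P : ℕ)
    (a : ℝ) : taylorSum g P a x ∈ sizeLE d (P * m) := by
  refine Submodule.sum_mem _ fun n hn => Submodule.smul_mem _ _ ?_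
  exact sizeLE_mono (Nat.mul_le_mul_right m (Finset.mem_range.1 hn).le) (pow_mem_sizeLE hx n)

/-! ### The action of characters on the forest algebra -/

/-- The contraction `g ⊗ id` of the left tensor factor. -/
noncomputable def contract (g : ForestAlg d →ₐ[ℝ] ℝ) (N : Type*) [AddCommGroup N] [Module ℝ N] :
    ForestAlg d ⊗[ℝ] N →ₗ[ℝ] N :=
  (TensorProduct.lid ℝ N).toLinearMap ∘ₗ g.toLinearMap.rTensor N

theorem contract_tmul (g : ForestAlg d →ₐ[ℝ] ℝ) {N : Type*} [AddCommGroup N] [Module ℝ N]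
    (x : ForestAlg d) (y : N) : contract g N (x ⊗ₜ y) = g x • y := by
  simp [contract]

theorem contract_lTensor (g : ForestAlg d →ₐ[ℝ] ℝ) {N N' : Type*} [AddCommGroup N] [Module ℝ N]
    [AddCommGroup N'] [Module ℝ N'] (φ : N →ₗ[ℝ] N') (x : ForestAlg d ⊗[ℝ] N) :
    contract g N' (φ.lTensor (ForestAlg d) x) = φ (contract g N x) := by
  induction x using TensorProduct.induction_on with
  | zero => simp
  | tmul x y => simp [contract_tmul]
  | add x y hx hy => simp only [map_add, hx, hy]

theorem structAction_apply (g : ForestAlg d →ₐ[ℝ] ℝ) (y : ModelSpace d) :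
    structAction g y = contract g _ (coaction y) := rfl

/-- The algebra morphism `(g ⊗ id) Δ` of the forest algebra. -/
noncomputable def charAction (g : ForestAlg d →ₐ[ℝ] ℝ) : ForestAlg d →ₐ[ℝ] ForestAlg d :=
  (Algebra.TensorProduct.lift ((Algebra.ofId ℝ (ForestAlg d)).comp g)
    (AlgHom.id ℝ (ForestAlg d)) fun _ _ => Commute.all _ _).comp coprod

theorem charAction_apply (g : ForestAlg d →ₐ[ℝ] ℝ) (x : ForestAlg d) :
    charAction g x = contract g _ (coprod x) := by
  rw [charAction, AlgHom.comp_apply]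
  induction coprod x using TensorProduct.induction_on with
  | zero => simp
  | tmul x y =>
    rw [contract_tmul, Algebra.TensorProduct.lift_tmul]
    simp [Algebra.ofId_apply, Algebra.smul_def]
  | add x y hx hy => simp only [map_add, hx, hy]

theorem ofForest_add (ζ ξ : Forest d) : ofForest (ζ + ξ) = ofForest ζ * ofForest ξ := by
  simp [ofForest, AddMonoidAlgebra.single_mul_single]

theorem forestAlg_hom_ext {N : Type*} [AddCommGroup N] [Module ℝ N] {φ ψ : ForestAlg d →ₗ[ℝ] N}
    (h : ∀ ζ, φ (ofForest ζ) = ψ (ofForest ζ)) : φ = ψ := by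
  refine AddMonoidAlgebra.lhom_ext' fun ζ => ?_
  ext
  exact h ζ

/-- Ξ_i is a spectator of the coaction. Since every forest occurs in some ζ Ξ_i, this also allows
all matrix coefficients of `charAction g` to be read off from the structure group. -/
theorem structAction_mulXi (g : ForestAlg d →ₐ[ℝ] ℝ) (i : Fin d) (x : ForestAlg d) :
    structAction g (mulXi i x) = mulXi i (charAction g x) := by
  suffices h : structAction g ∘ₗ mulXi i = mulXi i ∘ₗ (charAction g).toLinearMap from
    LinearMap.congr_fun h x
  refine forestAlg_hom_ext fun ζ => ?_
  simp only [LinearMap.comp_apply, AlgHom.toLinearMap_apply]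
  rw [charAction_apply, ← contract_lTensor, structAction_apply, mulXi, linExt_ofForest]
  congr 1
  simp [coaction, mulXi]

theorem toForestAlg_unit : toForestAlg (Finsupp.single (.unit : Sym d) 1) = 1 := by
  simp [toForestAlg]

theorem toForestAlg_tree (τ : Tree d) :
    toForestAlg (Finsupp.single (.tree τ) 1) = ofForest {τ} := by
  simp [toForestAlg]

theorem toForestAlg_noise (ζ : Forest d) (i : Fin d) :
    toForestAlg (Finsupp.single (.noise ζ i) 1) = 0 := by
  simp [toForestAlg]

theorem toForestAlg_mulXi (i : Fin d) (x : ForestAlg d) : toForestAlg (mulXi i x) = 0 := by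
  suffices h : toForestAlg ∘ₗ mulXi i = 0 from LinearMap.congr_fun h x
  refine forestAlg_hom_ext fun ζ => ?_
  rw [LinearMap.comp_apply, mulXi, linExt_ofForest, toForestAlg_noise, LinearMap.zero_apply]

/-- Transfers increments Y(t) - Γ_ts Y(s) to the forest algebra, where Γ_ts becomes multiplicative.
-/
theorem toForestAlg_structAction (g : ForestAlg d →ₐ[ℝ] ℝ) (y : ModelSpace d) :
    toForestAlg (structAction g y) = charAction g (toForestAlg y) := by
  suffices h : toForestAlg ∘ₗ structAction g = (charAction g).toLinearMap ∘ₗ toForestAlg from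
    LinearMap.congr_fun h y
  refine Finsupp.lhom_ext' fun σ => ?_
  ext
  simp only [LinearMap.comp_apply, AlgHom.toLinearMap_apply, Finsupp.lsingle_apply]
  rcases σ with _ | τ | ⟨ζ, i⟩
  · have : coaction (Finsupp.single (.unit : Sym d) 1) = 1 ⊗ₜ[ℝ] Finsupp.single .unit 1 := by
      simp [coaction]
    rw [structAction_apply, this, contract_tmul, map_one, one_smul, toForestAlg_unit, map_one]
  · rw [structAction_apply, ← contract_lTensor, toForestAlg_coaction_tree, toForestAlg_tree,
      charAction_apply]
  · have h : (Finsupp.single (.noise ζ i) 1 : ModelSpace d) = mulXi i (ofForest ζ) := by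
      rw [mulXi, linExt_ofForest]
    rw [h, structAction_mulXi, toForestAlg_mulXi, toForestAlg_mulXi, map_zero]

theorem graft_mem_sizeLT {n : ℕ} (i : Fin d) {x : ForestAlg d} (hx : x ∈ sizeLT d n) :
    graft i x ∈ sizeLT d (n + 1) := by
  rw [← AddMonoidAlgebra.sum_coeff_single x, Finsupp.sum, map_sum]
  refine Submodule.sum_mem _ fun ζ hζ => ?_
  have h1 : AddMonoidAlgebra.single ζ (x.coeff ζ) = x.coeff ζ • ofForest ζ := by simp [ofForest]
  rw [h1, map_smul, graft, linExt_ofForest]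
  refine Submodule.smul_mem _ _ (single_mem_supported ?_ 1)
  have : forestSize ζ < n := hx hζ
  simpa [forestSize_singleton, size_node] using this

/-- Characters act by unitriangular maps. -/
theorem charAction_ofForest_sub_mem (g : ForestAlg d →ₐ[ℝ] ℝ) (ζ : Forest d) :
    charAction g (ofForest ζ) - ofForest ζ ∈ sizeLT d (forestSize ζ) := by
  have hforest : ∀ ζ : Forest d,
      (∀ τ ∈ ζ, charAction g (ofForest {τ}) - ofForest {τ} ∈ sizeLT d τ.size) →
      charAction g (ofForest ζ) - ofForest ζ ∈ sizeLT d (forestSize ζ) := by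
    intro ζ
    induction ζ using Multiset.induction with
    | empty =>
      intro _
      have : ofForest (0 : Forest d) = 1 := rfl
      rw [this, map_one, sub_self]
      exact Submodule.zero_mem _
    | cons τ ζ ih =>
      intro h
      have h1 := h τ (Multiset.mem_cons_self τ ζ)
      have h2 := ih fun σ hσ => h σ (Multiset.mem_cons_of_mem hσ)
      rw [← Multiset.singleton_add, ofForest_add, map_mul, forestSize_add, forestSize_singleton]
      have hmul : ∀ {x y : ForestAlg d} {S T : Set (Forest d)},
          x ∈ AddMonoidAlgebra.supported ℝ ℝ S → y ∈ AddMonoidAlgebra.supported ℝ ℝ T →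
          (∀ ξ ∈ S, ∀ η ∈ T, forestSize ξ + forestSize η < τ.size + forestSize ζ) →
          x * y ∈ sizeLT d (τ.size + forestSize ζ) := fun hx hy hST =>
        mul_mem_supported (fun ξ hξ η hη => by
          rw [Set.mem_ofPred_eq, forestSize_add]; exact hST ξ hξ η hη) hx hy
      have hτ : ofForest {τ} ∈ AddMonoidAlgebra.supported ℝ ℝ {{τ}} :=
        single_mem_supported (Set.mem_singleton _) 1
      have hζ : ofForest ζ ∈ AddMonoidAlgebra.supported ℝ ℝ {ζ} :=
        single_mem_supported (Set.mem_singleton _) 1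
      -- With A = id + N on each factor, every term of the product other than the leading one
      -- contains some N, and N strictly lowers the number of vertices.
      have key : charAction g (ofForest {τ}) * charAction g (ofForest ζ) -
          ofForest {τ} * ofForest ζ =
          (charAction g (ofForest {τ}) - ofForest {τ}) * (charAction g (ofForest ζ) - ofForest ζ) +
          (charAction g (ofForest {τ}) - ofForest {τ}) * ofForest ζ +
          ofForest {τ} * (charAction g (ofForest ζ) - ofForest ζ) := by ring
      rw [key]
      refine Submodule.add_mem _ (Submodule.add_mem _ (hmul h1 h2 ?_) (hmul h1 hζ ?_))
        (hmul hτ h2 ?_)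
      · intro ξ hξ η hη
        exact add_lt_add (α := ℕ) hξ hη
      · rintro ξ hξ _ rfl
        exact Nat.add_lt_add_right hξ _
      · rintro _ rfl η hη
        rw [forestSize_singleton]
        exact Nat.add_lt_add_left hη _
  refine hforest ζ fun τ hτ => ?_
  clear hτ
  induction τ using Tree.induction with
  | h i ξ ih =>
    have hξ := graft_mem_sizeLT i (hforest ξ ih)
    have hc : coprod (ofForest {node i ξ}) = coprodTree (node i ξ) := by
      rw [coprod_ofForest, Multiset.map_singleton, Multiset.prod_singleton]
    have hg : graft i (ofForest ξ) = ofForest {node i ξ} := by rw [graft, linExt_ofForest]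
    rw [charAction_apply, hc, coprodTree_node, map_add, contract_tmul, contract_lTensor,
      ← charAction_apply, size_node, add_sub_assoc]
    rw [map_sub, hg] at hξ
    refine Submodule.add_mem _ (Submodule.smul_mem _ _ (single_mem_supported ?_ 1)) hξ
    simp [forestSize_zero]

/-- A forest with at least as many vertices as `ζ` occurs in `(g ⊗ id) Δ ζ` only if it is `ζ`. -/
theorem coeff_charAction_ofForest (g : ForestAlg d →ₐ[ℝ] ℝ) {ζ ξ : Forest d}
    (h : forestSize ζ ≤ forestSize ξ) :
    (charAction g (ofForest ζ)).coeff ξ = (ofForest ζ).coeff ξ := by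
  have := AddMonoidAlgebra.mem_supported'.1 (charAction_ofForest_sub_mem g ζ) ξ (by simpa using h)
  rw [AddMonoidAlgebra.coeff_sub, Finsupp.sub_apply] at this
  linarith

/-! ### Coordinates -/

theorem mulXi_noise (i : Fin d) (x : ForestAlg d) (ζ : Forest d) :
    mulXi i x (.noise ζ i) = x.coeff ζ := by
  classical
  suffices h : Finsupp.lapply (.noise ζ i) ∘ₗ mulXi i =
      Finsupp.lapply ζ ∘ₗ (AddMonoidAlgebra.coeffLinearEquiv ℝ).toLinearMap from
    LinearMap.congr_fun h x
  refine forestAlg_hom_ext fun ξ => ?_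
  simp only [LinearMap.comp_apply]
  rw [mulXi, linExt_ofForest]
  simp [ofForest, Finsupp.single_apply]

theorem mulXi_eq_zero (i : Fin d) (x : ForestAlg d) {σ : Sym d} (h : ∀ ζ, σ ≠ .noise ζ i) :
    mulXi i x σ = 0 := by
  classical
  suffices h : Finsupp.lapply σ ∘ₗ mulXi i = 0 from LinearMap.congr_fun h x
  refine forestAlg_hom_ext fun ξ => ?_
  simp only [LinearMap.comp_apply]
  rw [mulXi, linExt_ofForest]
  simp [(h ξ).symm]

theorem coeff_toForestAlg_zero (y : ModelSpace d) : (toForestAlg y).coeff 0 = y .unit := by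
  classical
  suffices h : (Finsupp.lapply 0 ∘ₗ (AddMonoidAlgebra.coeffLinearEquiv ℝ).toLinearMap) ∘ₗ
      toForestAlg = Finsupp.lapply (.unit : Sym d) from LinearMap.congr_fun h y
  refine Finsupp.lhom_ext' fun σ => ?_
  ext
  rcases σ with _ | τ | ⟨ζ, i⟩ <;>
    simp [toForestAlg, ofForest]

theorem coeff_toForestAlg_singleton (y : ModelSpace d) (τ : Tree d) :
    (toForestAlg y).coeff {τ} = y (.tree τ) := by
  classical
  suffices h : (Finsupp.lapply {τ} ∘ₗ (AddMonoidAlgebra.coeffLinearEquiv ℝ).toLinearMap) ∘ₗ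
      toForestAlg = Finsupp.lapply (.tree τ : Sym d) from LinearMap.congr_fun h y
  refine Finsupp.lhom_ext' fun σ => ?_
  ext
  rcases σ with _ | τ | ⟨ζ, i⟩ <;>
    simp [toForestAlg, ofForest, Finsupp.single_apply, AddMonoidAlgebra.one_def]

theorem coeff_toForestAlg_eq_zero (y : ModelSpace d) {ξ : Forest d} (h0 : ξ ≠ 0)
    (h1 : ∀ τ, ξ ≠ {τ}) : (toForestAlg y).coeff ξ = 0 := by
  classical
  suffices h : (Finsupp.lapply ξ ∘ₗ (AddMonoidAlgebra.coeffLinearEquiv ℝ).toLinearMap) ∘ₗ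
      toForestAlg = (0 : ModelSpace d →ₗ[ℝ] ℝ) from LinearMap.congr_fun h y
  refine Finsupp.lhom_ext' fun σ => ?_
  ext
  rcases σ with _ | τ | ⟨ζ, i⟩ <;>
    simp [toForestAlg, ofForest, AddMonoidAlgebra.one_def, h0.symm,
      (h1 _).symm]

/-- Only the empty forest and single trees occur in the image, and the homogeneity of the
corresponding symbol is γ times the number of vertices. Bounds on coordinates of y thus become
bounds on forest coefficients. -/
theorem coeff_toForestAlg_cases (γ : ℝ) (y : ModelSpace d) (ζ : Forest d) :
    (toForestAlg y).coeff ζ = 0 ∨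
      ∃ σ, homogeneity γ σ = γ * forestSize ζ ∧ (toForestAlg y).coeff ζ = y σ := by
  by_cases h0 : ζ = 0
  · subst h0
    exact Or.inr ⟨.unit, by simp [homogeneity, forestSize_zero], coeff_toForestAlg_zero y⟩
  · by_cases h1 : ∃ τ, ζ = {τ}
    · obtain ⟨τ, rfl⟩ := h1
      exact Or.inr ⟨.tree τ, by rw [homogeneity, forestSize_singleton],
        coeff_toForestAlg_singleton y τ⟩
    · exact Or.inl (coeff_toForestAlg_eq_zero y h0 fun τ hτ => h1 ⟨τ, hτ⟩)

end Forests

end BranchedRS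

/-! ### The norms of modelled distributions -/

namespace BranchedRS

section Norms

variable {S : Type} {deg : S → ℝ}

theorem projHomog_add (β : ℝ) (x y : S →₀ ℝ) :
    projHomog deg β (x + y) = projHomog deg β x + projHomog deg β y :=
  Finsupp.filter_add

theorem homNorm_eq_sqrt_sum {β : ℝ} {x : S →₀ ℝ} {s : Finset S}
    (hs : (projHomog deg β x).support ⊆ s) :
    homNorm deg β x = Real.sqrt (∑ σ ∈ s, projHomog deg β x σ ^ 2) := by
  rw [homNorm, Finsupp.sum_of_support_subset _ hs _ (by simp)]

theorem homNorm_nonneg (β : ℝ) (x : S →₀ ℝ) : 0 ≤ homNorm deg β x := Real.sqrt_nonneg _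

theorem homNorm_zero (β : ℝ) : homNorm deg β 0 = 0 := by
  have h : projHomog deg β (0 : S →₀ ℝ) = 0 := Finsupp.filter_zero _
  rw [homNorm, h, Finsupp.sum_zero_index, Real.sqrt_zero]

theorem homNorm_neg (β : ℝ) (x : S →₀ ℝ) : homNorm deg β (-x) = homNorm deg β x := by
  have h : projHomog deg β (-x) = -projHomog deg β x := Finsupp.filter_neg _ _
  rw [homNorm, homNorm, h, Finsupp.sum_neg_index (by simp)]
  simp

theorem homNorm_add_le (β : ℝ) (x y : S →₀ ℝ) :
    homNorm deg β (x + y) ≤ homNorm deg β x + homNorm deg β y := by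
  classical
  set s := (projHomog deg β x).support ∪ (projHomog deg β y).support
  have h : ∀ z : S →₀ ℝ, (projHomog deg β z).support ⊆ s → homNorm deg β z =
      ‖(WithLp.toLp 2 fun σ : s => projHomog deg β z σ : EuclideanSpace ℝ s)‖ := by
    intro z hz
    rw [homNorm_eq_sqrt_sum hz, EuclideanSpace.norm_eq, ← Finset.sum_coe_sort]
    simp
  rw [h _ Finset.subset_union_left, h _ Finset.subset_union_right,
    h _ (by rw [projHomog_add]; exact Finsupp.support_add)]
  refine (le_of_eq ?_).trans (norm_add_le _ _)
  congr 1
  ext σ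
  simp [projHomog_add]

theorem abs_apply_le_homNorm (x : S →₀ ℝ) (σ : S) : |x σ| ≤ homNorm deg (deg σ) x := by
  classical
  have h : projHomog deg (deg σ) x σ = x σ := by simp [projHomog]
  rw [homNorm_eq_sqrt_sum (Finset.subset_insert σ _), ← h, ← Real.sqrt_sq_eq_abs]
  refine Real.sqrt_le_sqrt ?_
  exact Finset.single_le_sum (f := fun τ => projHomog deg (deg σ) x τ ^ 2)
    (fun τ _ => sq_nonneg _) (Finset.mem_insert_self _ _)

/-- Crude comparison ℓ² ≤ ℓ¹ ≤ card · ℓ^∞. Constants depending on the number of symbols are harmless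
because only finitely many are involved. -/
theorem homNorm_le_card_mul {β : ℝ} {x : S →₀ ℝ} (s : Finset S) {c : ℝ} (hc : 0 ≤ c)
    (hs : ∀ σ, deg σ = β → x σ ≠ 0 → σ ∈ s) (h : ∀ σ, deg σ = β → |x σ| ≤ c) :
    homNorm deg β x ≤ s.card * c := by
  classical
  have hsub : (projHomog deg β x).support ⊆ s := by
    intro σ hσ
    have := Finsupp.mem_support_iff.1 hσ
    simp only [projHomog, Finsupp.filter_apply] at this
    split_ifs at this with hd
    · exact hs σ hd this
    · exact absurd rfl this
  rw [homNorm_eq_sqrt_sum hsub]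
  refine Real.sqrt_le_iff.2 ⟨by positivity, ?_⟩
  have hle : ∀ σ ∈ s, |projHomog deg β x σ| ≤ c := by
    intro σ _
    simp only [projHomog, Finsupp.filter_apply]
    split_ifs with hd
    · exact h σ hd
    · simpa using hc
  calc ∑ σ ∈ s, projHomog deg β x σ ^ 2 = ∑ σ ∈ s, |projHomog deg β x σ| ^ 2 := by simp
    _ ≤ (∑ σ ∈ s, |projHomog deg β x σ|) ^ 2 :=
        Finset.sum_sq_le_sq_sum_of_nonneg fun _ _ => abs_nonneg _
    _ ≤ (s.card * c) ^ 2 := by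
        have := Finset.sum_le_card_nsmul s _ c hle
        rw [nsmul_eq_mul] at this
        have h0 : 0 ≤ ∑ σ ∈ s, |projHomog deg β x σ| := Finset.sum_nonneg fun _ _ => abs_nonneg _
        gcongr

/-! ### Bounds read off from and assembled into the modelled distribution norm -/

variable {Γ : ℝ → ℝ → ((S →₀ ℝ) →ₗ[ℝ] (S →₀ ℝ))} {η : ℝ} {K : Set ℝ}

theorem mdNorm_le {F : ℝ → (S →₀ ℝ)} {c₁ c₂ : ℝ≥0∞}
    (h₁ : ∀ x ∈ K, ∀ β ∈ indexSet deg, β < η → ENNReal.ofReal (homNorm deg β (F x)) ≤ c₁)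
    (h₂ : ∀ x ∈ K, ∀ y ∈ K, 0 < dist x y → dist x y ≤ 1 → ∀ β ∈ indexSet deg, β < η →
      ENNReal.ofReal (homNorm deg β (F x - Γ x y (F y)) / dist x y ^ (η - β)) ≤ c₂) :
    mdNorm deg Γ η K F ≤ c₁ + c₂ := by
  refine add_le_add ?_ ?_
  · exact iSup₂_le fun x hx => iSup₂_le fun β hβ => h₁ x hx β hβ.1 hβ.2
  · exact iSup₂_le fun x hx => iSup₂_le fun y hy => iSup_le fun hxy => iSup₂_le fun β hβ =>
      h₂ x hx y hy hxy.1 hxy.2 β hβ.1 hβ.2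

theorem ofReal_homNorm_le (F : ℝ → (S →₀ ℝ)) {x : ℝ} (hx : x ∈ K) {β : ℝ}
    (hβ : β ∈ indexSet deg) (hβη : β < η) :
    ENNReal.ofReal (homNorm deg β (F x)) ≤
      ⨆ x ∈ K, ⨆ β ∈ indexSet deg ∩ Set.Iio η, ENNReal.ofReal (homNorm deg β (F x)) :=
  le_iSup₂_of_le x hx (le_iSup₂_of_le β ⟨hβ, hβη⟩ le_rfl)

theorem ofReal_homNorm_sub_le (F : ℝ → (S →₀ ℝ)) {x y : ℝ} (hx : x ∈ K) (hy : y ∈ K)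
    (h0 : 0 < dist x y) (h1 : dist x y ≤ 1) {β : ℝ} (hβ : β ∈ indexSet deg) (hβη : β < η) :
    ENNReal.ofReal (homNorm deg β (F x - Γ x y (F y)) / dist x y ^ (η - β)) ≤
      ⨆ x ∈ K, ⨆ y ∈ K, ⨆ (_ : 0 < dist x y ∧ dist x y ≤ 1), ⨆ β ∈ indexSet deg ∩ Set.Iio η,
        ENNReal.ofReal (homNorm deg β (F x - Γ x y (F y)) / dist x y ^ (η - β)) :=
  le_iSup₂_of_le x hx <| le_iSup₂_of_le y hy <| le_iSup_of_le ⟨h0, h1⟩ <|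
    le_iSup₂_of_le β ⟨hβ, hβη⟩ le_rfl

theorem homNorm_le_of_mdNorm_le {F : ℝ → (S →₀ ℝ)} {c : ℝ} (hc : 0 ≤ c)
    (h : mdNorm deg Γ η K F ≤ ENNReal.ofReal c) {x : ℝ} (hx : x ∈ K) {β : ℝ}
    (hβ : β ∈ indexSet deg) (hβη : β < η) : homNorm deg β (F x) ≤ c :=
  (ENNReal.ofReal_le_ofReal_iff hc).1
    ((ofReal_homNorm_le F hx hβ hβη).trans (le_self_add.trans h))

theorem homNorm_sub_le_of_mdNorm_le {F : ℝ → (S →₀ ℝ)} {c : ℝ} (hc : 0 ≤ c)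
    (h : mdNorm deg Γ η K F ≤ ENNReal.ofReal c) {x y : ℝ} (hx : x ∈ K) (hy : y ∈ K)
    (h0 : 0 < dist x y) (h1 : dist x y ≤ 1) {β : ℝ} (hβ : β ∈ indexSet deg) (hβη : β < η) :
    homNorm deg β (F x - Γ x y (F y)) ≤ c * dist x y ^ (η - β) := by
  have := (ENNReal.ofReal_le_ofReal_iff hc).1
    ((ofReal_homNorm_sub_le F hx hy h0 h1 hβ hβη).trans (le_add_self.trans h))
  rwa [div_le_iff₀ (Real.rpow_pos_of_pos h0 _)] at this

theorem mdNorm_add_le (F G : ℝ → (S →₀ ℝ)) :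
    mdNorm deg Γ η K (fun t => F t + G t) ≤ mdNorm deg Γ η K F + mdNorm deg Γ η K G := by
  have h : ∀ a b c d : ℝ≥0∞, (a + b) + (c + d) = (a + c) + (b + d) := fun a b c d =>
    add_add_add_comm a b c d
  rw [mdNorm.eq_1 (F := F), mdNorm.eq_1 (F := G), h]
  refine mdNorm_le (fun x hx β hβ hβη => ?_) fun x hx y hy h0 h1 β hβ hβη => ?_
  · refine (ENNReal.ofReal_le_ofReal (homNorm_add_le β _ _)).trans ?_
    rw [ENNReal.ofReal_add (homNorm_nonneg _ _) (homNorm_nonneg _ _)]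
    exact add_le_add (ofReal_homNorm_le F hx hβ hβη) (ofReal_homNorm_le G hx hβ hβη)
  · have hd : 0 ≤ dist x y ^ (η - β) := (Real.rpow_pos_of_pos h0 _).le
    have heq : F x + G x - Γ x y (F y + G y) = (F x - Γ x y (F y)) + (G x - Γ x y (G y)) := by
      rw [map_add]; abel
    refine (ENNReal.ofReal_le_ofReal ?_).trans ((ENNReal.ofReal_add
      (div_nonneg (homNorm_nonneg β (F x - Γ x y (F y))) hd)
      (div_nonneg (homNorm_nonneg β (G x - Γ x y (G y))) hd)).le.trans
        (add_le_add (ofReal_homNorm_sub_le F hx hy h0 h1 hβ hβη)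
          (ofReal_homNorm_sub_le G hx hy h0 h1 hβ hβη)))
    rw [← add_div, heq]
    exact div_le_div_of_nonneg_right (homNorm_add_le β _ _) hd

theorem mdNorm_neg (F : ℝ → (S →₀ ℝ)) :
    mdNorm deg Γ η K (fun t => -F t) = mdNorm deg Γ η K F := by
  have h : ∀ x y, -F x - Γ x y (-F y) = -(F x - Γ x y (F y)) := fun x y => by
    rw [map_neg]; abel
  simp only [mdNorm, h, homNorm_neg]

theorem mdNorm_zero : mdNorm deg Γ η K (fun _ => 0) = 0 := by
  simp [mdNorm, homNorm_zero]

theorem mdNorm_sub_le (F G : ℝ → (S →₀ ℝ)) :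
    mdNorm deg Γ η K (fun t => F t - G t) ≤ mdNorm deg Γ η K F + mdNorm deg Γ η K G := by
  have := mdNorm_add_le (deg := deg) (Γ := Γ) (η := η) (K := K) F fun t => -G t
  rw [mdNorm_neg] at this
  simpa only [sub_eq_add_neg] using this

theorem mdNorm_sub_triangle (F G H : ℝ → (S →₀ ℝ)) :
    mdNorm deg Γ η K (fun t => F t - H t) ≤
      mdNorm deg Γ η K (fun t => F t - G t) + mdNorm deg Γ η K (fun t => G t - H t) := by
  have := mdNorm_add_le (deg := deg) (Γ := Γ) (η := η) (K := K) (fun t => F t - G t)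
    fun t => G t - H t
  simpa only [sub_add_sub_cancel] using this

/-- A map of modelled distributions that is Lipschitz on bounded sets, for each seminorm, is
continuous. -/
theorem continuous_of_locally_lipschitz {deg' : S → ℝ} {V W : Submodule ℝ (S →₀ ℝ)} {η' : ℝ}
    {Γ' : ℝ → ℝ → ((S →₀ ℝ) →ₗ[ℝ] (S →₀ ℝ))}
    (Φ : ModelledDistribution deg Γ V η → ModelledDistribution deg' Γ' W η')
    (h : ∀ K : Set ℝ, IsCompact K → ∀ D : ℝ, 0 < D → ∃ C : ℝ, 0 < C ∧
      ∀ F G : ModelledDistribution deg Γ V η,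
      mdNorm deg Γ η K F + mdNorm deg Γ η K G ≤ ENNReal.ofReal D →
        mdNorm deg' Γ' η' K (fun t => Φ F t - Φ G t) ≤
          ENNReal.ofReal C * mdNorm deg Γ η K (fun t => F t - G t)) : Continuous Φ := by
  refine continuous_generateFrom_iff.2 ?_
  rintro U ⟨K, F₀, ε, hK, -, rfl⟩
  refine isOpen_iff_mem_nhds.2 fun Y hY => ?_
  have hY' : mdNorm deg' Γ' η' K (fun t => Φ Y t - F₀ t) < ε := hY
  set m := (mdNorm deg Γ η K Y).toReal
  have hm : mdNorm deg Γ η K Y = ENNReal.ofReal m :=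
    (ENNReal.ofReal_toReal (Y.finite K hK).ne).symm
  have hm0 : 0 ≤ m := ENNReal.toReal_nonneg
  -- If Z is within distance 1 of Y, its norm is at most m + 1, and Y itself contributes m.
  obtain ⟨C, hC, hLip⟩ := h K hK (2 * m + 1) (by positivity)
  -- The intermediate δ leaves room for a non-strict estimate by δ followed by the strict inequality
  -- δ < ε.
  obtain ⟨δ, hδ, hδε⟩ := exists_between hY'
  have hgap : 0 < (δ - mdNorm deg' Γ' η' K (fun t => Φ Y t - F₀ t)) / ENNReal.ofReal C :=
    ENNReal.div_pos (tsub_pos_of_lt hδ).ne' ENNReal.ofReal_ne_top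
  set e := min 1 ((δ - mdNorm deg' Γ' η' K (fun t => Φ Y t - F₀ t)) / ENNReal.ofReal C)
  have he : 0 < e := lt_min one_pos hgap
  have hopen : IsOpen {H : ModelledDistribution deg Γ V η |
      mdNorm deg Γ η K (fun t => H t - Y t) < e} :=
    TopologicalSpace.isOpen_generateFrom_of_mem ⟨K, Y, e, hK, he, rfl⟩
  refine Filter.mem_of_superset (hopen.mem_nhds ?_) fun Z hZ => ?_
  · change mdNorm deg Γ η K (fun t => Y t - Y t) < e
    simpa only [sub_self, mdNorm_zero] using he
  · have hZe : mdNorm deg Γ η K (fun t => Z t - Y t) < e := hZ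
    change mdNorm deg' Γ' η' K (fun t => Φ Z t - F₀ t) < ε
    have hZ1 : mdNorm deg Γ η K Z ≤ 1 + mdNorm deg Γ η K Y := by
      have := mdNorm_sub_triangle (deg := deg) (Γ := Γ) (η := η) (K := K) Z Y fun _ => 0
      simp only [sub_zero] at this
      exact this.trans (add_le_add (hZe.le.trans (min_le_left _ _)) le_rfl)
    have hb : mdNorm deg Γ η K Z + mdNorm deg Γ η K Y ≤ ENNReal.ofReal (2 * m + 1) := by
      refine (add_le_add hZ1 le_rfl).trans (le_of_eq ?_)
      rw [hm, ← ENNReal.ofReal_one, ← ENNReal.ofReal_add zero_le_one hm0,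
        ← ENNReal.ofReal_add (by positivity) hm0]
      congr 1
      ring
    have h1 := hLip Z Y hb
    have h2 : ENNReal.ofReal C * mdNorm deg Γ η K (fun t => Z t - Y t) ≤
        δ - mdNorm deg' Γ' η' K (fun t => Φ Y t - F₀ t) := by
      refine (mul_le_mul_right (hZe.le.trans (min_le_right _ _)) _).trans ?_
      exact ENNReal.mul_div_le
    refine (mdNorm_sub_triangle _ (Φ Y).toFun _).trans_lt (lt_of_le_of_lt ?_ hδε)
    exact (add_le_add (h1.trans h2) le_rfl).trans (tsub_add_cancel_of_le hδ.le).le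

end Norms

end BranchedRS

/-! ### Truncation and composition with smooth functions in the forest algebra -/

namespace BranchedRS

section Composition

variable {d : ℕ}

open scoped Classical in
/-- The projection onto the linear combinations of forests with less than `P` vertices. -/
noncomputable def trunc (d P : ℕ) : ForestAlg d →ₗ[ℝ] ForestAlg d :=
  linExt fun ζ => if forestSize ζ < P then ofForest ζ else 0

theorem coeff_trunc {P : ℕ} {ζ : Forest d} (hζ : forestSize ζ < P) (x : ForestAlg d) :
    (trunc d P x).coeff ζ = x.coeff ζ := by
  classical
  suffices h : (Finsupp.lapply ζ ∘ₗ (AddMonoidAlgebra.coeffLinearEquiv ℝ).toLinearMap) ∘ₗ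
      trunc d P = Finsupp.lapply ζ ∘ₗ (AddMonoidAlgebra.coeffLinearEquiv ℝ).toLinearMap from
    LinearMap.congr_fun h x
  refine forestAlg_hom_ext fun ξ => ?_
  simp only [LinearMap.comp_apply]
  rw [trunc, linExt_ofForest]
  split_ifs with h
  · rfl
  · have : ξ ≠ ζ := by rintro rfl; exact h hζ
    simp [ofForest, this]

theorem coeff_trunc_eq_zero {P : ℕ} {ζ : Forest d} (hζ : ¬ forestSize ζ < P) (x : ForestAlg d) :
    (trunc d P x).coeff ζ = 0 := by
  classical
  suffices h : (Finsupp.lapply ζ ∘ₗ (AddMonoidAlgebra.coeffLinearEquiv ℝ).toLinearMap) ∘ₗ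
      trunc d P = 0 from LinearMap.congr_fun h x
  refine forestAlg_hom_ext fun ξ => ?_
  simp only [LinearMap.comp_apply]
  rw [trunc, linExt_ofForest]
  split_ifs with h
  · have : ξ ≠ ζ := by rintro rfl; exact hζ h
    simp [ofForest, this]
  · simp

theorem trunc_eq_zero {P : ℕ} {x : ForestAlg d} (hx : x ∈ sizeGE d P) : trunc d P x = 0 := by
  refine AddMonoidAlgebra.ext (Finsupp.ext fun ζ => ?_)
  by_cases hζ : forestSize ζ < P
  · rw [coeff_trunc hζ, coeff_eq_zero_of_mem_sizeGE hx hζ]; rfl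
  · rw [coeff_trunc_eq_zero hζ]; rfl

/-- The `ℓ¹` norm on the forest algebra. -/
noncomputable def l1Norm (d : ℕ) : Seminorm ℝ (ForestAlg d) :=
  weightSeminorm (fun _ => 1) fun _ => zero_le_one

open scoped Classical in
/-- The weight `r ^ |ζ|` of forests with less than `P` vertices. -/
noncomputable def truncWeight (P : ℕ) (r : ℝ) (ζ : Forest d) : ℝ :=
  if forestSize ζ < P then r ^ forestSize ζ else 0

theorem truncWeight_nonneg (P : ℕ) {r : ℝ} (hr : 0 ≤ r) (ζ : Forest d) : 0 ≤ truncWeight P r ζ := by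
  unfold truncWeight
  split_ifs <;> positivity

/-- The seminorm `∑ r ^ |ζ| |x_ζ|`, the sum running over the forests with less than `P` vertices. -/
noncomputable def truncNorm (d P : ℕ) {r : ℝ} (hr : 0 ≤ r) : Seminorm ℝ (ForestAlg d) :=
  weightSeminorm (truncWeight P r) (truncWeight_nonneg P hr)

theorem l1Norm_mul_le (x y : ForestAlg d) : l1Norm d (x * y) ≤ l1Norm d x * l1Norm d y :=
  weightSeminorm_mul_le (fun _ _ => by norm_num) x y

theorem l1Norm_one_le : l1Norm d 1 ≤ 1 := by
  rw [l1Norm, AddMonoidAlgebra.one_def, weightSeminorm_single]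
  simp

/-! ### Properties of the ℓ¹ norm and of the scaled norm -/

variable {P : ℕ} {r : ℝ} {hr : 0 ≤ r}

/-- Truncation does not spoil submultiplicativity: if a union of forests has less than P vertices,
so has each part, and there the weights r^|ζ| multiply exactly. -/
theorem truncNorm_mul_le (x y : ForestAlg d) :
    truncNorm d P hr (x * y) ≤ truncNorm d P hr x * truncNorm d P hr y := by
  refine weightSeminorm_mul_le (fun ζ ξ => ?_) x y
  by_cases h : forestSize (ζ + ξ) < P
  · have h' := h
    rw [forestSize_add] at h'
    rw [truncWeight, truncWeight, truncWeight, if_pos h, if_pos (by omega), if_pos (by omega),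
      forestSize_add, pow_add]
  · rw [truncWeight, if_neg h]
    exact mul_nonneg (truncWeight_nonneg P hr _) (truncWeight_nonneg P hr _)

theorem truncNorm_ofForest (ζ : Forest d) :
    truncNorm d P hr (ofForest ζ) = truncWeight P r ζ := by
  rw [truncNorm, ofForest, weightSeminorm_single, abs_one, one_mul]

theorem truncNorm_one_le : truncNorm d P hr (1 : ForestAlg d) ≤ 1 := by
  have h : (1 : ForestAlg d) = ofForest 0 := rfl
  rw [h, truncNorm_ofForest, truncWeight, forestSize_zero]
  split_ifs <;> simp

theorem truncNorm_le_l1Norm (hr1 : r ≤ 1) (x : ForestAlg d) :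
    truncNorm d P hr x ≤ l1Norm d x := by
  have := seminorm_linearMap_le (w := fun _ : Forest d => (1 : ℝ)) (hw := fun _ => zero_le_one)
    (truncNorm d P hr) LinearMap.id x (C := 1) fun ζ _ => by
      refine (truncNorm_ofForest ζ).trans_le ?_
      rw [truncWeight]
      split_ifs
      · simpa using pow_le_one₀ hr hr1
      · simp
  simpa [l1Norm] using this

theorem abs_coeff_mul_le_weightSeminorm {M : Type*} [AddCommMonoid M] {w : M → ℝ}
    {hw : ∀ m, 0 ≤ w m} (x : AddMonoidAlgebra ℝ M) (m : M) :
    |x.coeff m| * w m ≤ weightSeminorm w hw x := by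
  classical
  rw [weightSeminorm_apply, Finsupp.sum_of_support_subset _ (Finset.subset_insert m _) _ (by simp)]
  exact Finset.single_le_sum (f := fun n => |x.coeff n| * w n)
    (fun n _ => mul_nonneg (abs_nonneg _) (hw n)) (Finset.mem_insert_self _ _)

theorem abs_coeff_le_l1Norm (x : ForestAlg d) (ζ : Forest d) : |x.coeff ζ| ≤ l1Norm d x := by
  have := abs_coeff_mul_le_weightSeminorm (w := fun _ => (1 : ℝ)) (hw := fun _ => zero_le_one) x ζ
  rwa [mul_one] at this

theorem abs_coeff_mul_le_truncNorm (x : ForestAlg d) {ζ : Forest d} (hζ : forestSize ζ < P) :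
    |x.coeff ζ| * r ^ forestSize ζ ≤ truncNorm d P hr x := by
  have := abs_coeff_mul_le_weightSeminorm (hw := truncWeight_nonneg P hr) x ζ
  rwa [truncWeight, if_pos hζ] at this

theorem truncNorm_le_card_mul (x : ForestAlg d) {c : ℝ}
    (h : ∀ ζ, forestSize ζ < P → |x.coeff ζ| * r ^ forestSize ζ ≤ c) :
    truncNorm d P hr x ≤ (smallForests d P).card * c := by
  refine (weightSeminorm_le_sum x (smallForests d P) fun ζ hζ => ?_).trans ?_
  · right
    rw [truncWeight, if_neg (by rwa [mem_smallForests] at hζ)]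
  · rw [← nsmul_eq_mul]
    refine Finset.sum_le_card_nsmul _ _ _ fun ζ hζ => ?_
    rw [mem_smallForests] at hζ
    rw [truncWeight, if_pos hζ]
    exact h ζ hζ

theorem l1Norm_le_card_mul {x : ForestAlg d} {c : ℝ}
    (hx : ∀ ζ, ¬ forestSize ζ < P → x.coeff ζ = 0) (h : ∀ ζ, |x.coeff ζ| ≤ c) :
    l1Norm d x ≤ (smallForests d P).card * c := by
  refine (weightSeminorm_le_sum x (smallForests d P) fun ζ hζ => ?_).trans ?_
  · exact Or.inl (hx ζ (by rwa [mem_smallForests] at hζ))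
  · rw [← nsmul_eq_mul]
    refine Finset.sum_le_card_nsmul _ _ _ fun ζ _ => ?_
    simpa using h ζ

/-- An element of the forest algebra without its component along the empty forest. -/
noncomputable def reduced (x : ForestAlg d) : ForestAlg d := x - x.coeff 0 • 1

theorem reduced_add (x y : ForestAlg d) : reduced (x + y) = reduced x + reduced y := by
  simp only [reduced, AddMonoidAlgebra.coeff_add, Finsupp.add_apply, add_smul]
  abel

theorem reduced_smul (c : ℝ) (x : ForestAlg d) : reduced (c • x) = c • reduced x := by
  simp only [reduced, AddMonoidAlgebra.coeff_smul, Finsupp.smul_apply, smul_sub, smul_assoc]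

theorem reduced_mem_sizeGE (x : ForestAlg d) : reduced x ∈ sizeGE d 1 := by
  refine AddMonoidAlgebra.mem_supported'.2 fun ζ hζ => ?_
  have h0 : forestSize ζ = 0 := by
    have : ¬ 1 ≤ forestSize ζ := hζ
    omega
  have h : ζ = 0 := by
    have := card_le_forestSize ζ
    rw [h0] at this
    exact Multiset.card_eq_zero.1 (Nat.le_zero.1 this)
  subst h
  simp [reduced]

theorem reduced_mem_sizeLE {n : ℕ} {x : ForestAlg d} (hx : x ∈ sizeLE d n) :
    reduced x ∈ sizeLE d n :=
  Submodule.sub_mem _ hx (Submodule.smul_mem _ _ (sizeLE_mono n.zero_le one_mem_sizeLE))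

theorem l1Norm_reduced_le (x : ForestAlg d) : l1Norm d (reduced x) ≤ 2 * l1Norm d x := by
  refine (map_sub_le_add _ _ _).trans ?_
  rw [map_smul_eq_mul, Real.norm_eq_abs]
  have h1 := abs_coeff_le_l1Norm x 0
  have := mul_le_mul h1 (l1Norm_one_le (d := d)) (apply_nonneg _ _) (apply_nonneg _ _)
  linarith

/-- The (untruncated) composition `∑_{n < P} g⁽ⁿ⁾(x^𝟏)/n! (x - x^𝟏 𝟏)ⁿ`. -/
noncomputable def compose (g : ℝ → ℝ) (P : ℕ) (x : ForestAlg d) : ForestAlg d :=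
  taylorSum g P (x.coeff 0) (reduced x)

/-- The map `A` is bounded uniformly in the scaled norms, on forests with at most `Q` vertices. -/
def ScaledBound (A : ForestAlg d →ₐ[ℝ] ForestAlg d) (P Q : ℕ) {r : ℝ} (hr : 0 ≤ r) (C : ℝ) : Prop :=
  ∀ ζ : Forest d, forestSize ζ ≤ Q → truncNorm d P hr (A (ofForest ζ)) ≤ C * r ^ forestSize ζ

/-! ### Scaled bounds for algebra morphisms and stability of compositions -/

variable {A : ForestAlg d →ₐ[ℝ] ForestAlg d} {Q : ℕ} {C : ℝ}

theorem ScaledBound.le (hA : ScaledBound A P Q hr C) (hC : 0 ≤ C) (hr1 : r ≤ 1) {m : ℕ}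
    {x : ForestAlg d} (hx : x ∈ sizeLE d Q) (hx' : x ∈ sizeGE d m) :
    truncNorm d P hr (A x) ≤ C * r ^ m * l1Norm d x := by
  refine seminorm_linearMap_le (w := fun _ => (1 : ℝ)) (hw := fun _ => zero_le_one)
    (truncNorm d P hr) A.toLinearMap x fun ζ hζ => ?_
  rw [mul_one, AlgHom.toLinearMap_apply]
  have hζQ : forestSize ζ ≤ Q := hx hζ
  have hζm : m ≤ forestSize ζ := hx' hζ
  exact (hA ζ hζQ).trans
    (mul_le_mul_of_nonneg_left (pow_le_pow_of_le_one hr hr1 hζm) hC)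

/-- Only forests with at least P vertices survive in x - `trunc d P x`, and each costs at least P
powers of r. This is the error made by truncating before re-expanding. -/
theorem ScaledBound.sub_trunc_le (hA : ScaledBound A P Q hr C) (hC : 0 ≤ C) (hr1 : r ≤ 1)
    {x : ForestAlg d} (hx : x ∈ sizeLE d Q) :
    truncNorm d P hr (A (x - trunc d P x)) ≤ C * r ^ P * l1Norm d x := by
  have hx0 : A (x - trunc d P x) = (A.toLinearMap ∘ₗ (LinearMap.id - trunc d P)) x := by
    rw [LinearMap.comp_apply, LinearMap.sub_apply, LinearMap.id_apply, AlgHom.toLinearMap_apply]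
  rw [hx0]
  refine seminorm_linearMap_le (w := fun _ => (1 : ℝ)) (hw := fun _ => zero_le_one)
    (truncNorm d P hr) (A.toLinearMap ∘ₗ (LinearMap.id - trunc d P)) x fun ζ hζ => ?_
  rw [mul_one]
  have h : (LinearMap.id - trunc d P : ForestAlg d →ₗ[ℝ] ForestAlg d)
      (AddMonoidAlgebra.single ζ 1) = ofForest ζ - trunc d P (ofForest ζ) := rfl
  rw [LinearMap.comp_apply, h, trunc, linExt_ofForest]
  split_ifs with hP
  · rw [sub_self, map_zero, map_zero]
    positivity
  · rw [sub_zero]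
    refine (hA ζ (hx hζ)).trans (mul_le_mul_of_nonneg_left ?_ hC)
    exact pow_le_pow_of_le_one hr hr1 (not_lt.1 hP)

theorem l1Norm_compose_le {g : ℝ → ℝ} {B D : ℝ} (hD : 1 ≤ D)
    (hB : ∀ n ≤ P, ∀ y, |y| ≤ D → |iteratedDeriv n g y| ≤ B) {x : ForestAlg d}
    (hx : l1Norm d x ≤ D) : l1Norm d (compose g P x) ≤ P * (B * (2 * D) ^ P) :=
  seminorm_taylorSum_le l1Norm_mul_le l1Norm_one_le (by linarith)
    ((l1Norm_reduced_le x).trans (by linarith))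
    fun n hn => hB n hn _ ((abs_coeff_le_l1Norm x 0).trans hx)

/-- Composition with a smooth function preserves modelled distributions. -/
theorem truncNorm_compose_sub_le (hP : 0 < P) (hPQ : P ≤ Q) (hA : ScaledBound A P Q hr C)
    (hC : 1 ≤ C) {κ ρ : ℝ} (hrκ : r ≤ κ) (hρκ : ρ ≤ κ) (hκ1 : κ ≤ 1) (hκρ : κ ^ P ≤ ρ) {g : ℝ → ℝ}
    (hg : ContDiff ℝ P g) {B D : ℝ} (hD : 1 ≤ D)
    (hB : ∀ n ≤ P, ∀ y, |y| ≤ D → |iteratedDeriv n g y| ≤ B) {x x' : ForestAlg d}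
    (hx : l1Norm d x ≤ D) (hx' : l1Norm d x' ≤ D) (hxP' : x' ∈ sizeLE d P)
    (hxx : truncNorm d P hr (x - A x') ≤ D * ρ) :
    truncNorm d P hr (compose g P x - A (compose g P x')) ≤
      (P * (B * (P * (3 * (3 * C * D)) ^ P * (3 * C * D))) + P * (B * (3 * C * D) ^ P)) * ρ := by
  have hCD : 1 ≤ C * D := one_le_mul_of_one_le_of_one_le hC hD
  have hκ0 : 0 ≤ κ := hr.trans hrκ
  have hρ0 : 0 ≤ ρ := (pow_nonneg hκ0 P).trans hκρ
  have hz : truncNorm d P hr (A (reduced x')) ≤ 2 * (C * D) * κ := by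
    have h := hA.le (by linarith) (hrκ.trans hκ1) (sizeLE_mono hPQ (reduced_mem_sizeLE hxP'))
      (reduced_mem_sizeGE x')
    rw [pow_one] at h
    have h2 : l1Norm d (reduced x') ≤ 2 * D := (l1Norm_reduced_le x').trans (by linarith)
    calc _ ≤ C * r * l1Norm d (reduced x') := h
      _ ≤ C * κ * (2 * D) := by gcongr
      _ = _ := by ring
  have hAx : A x' = x'.coeff 0 • 1 + A (reduced x') := by
    rw [reduced, map_sub, map_smul, map_one]
    abel
  -- The increment of the 𝟏-coefficient has two sources: the remainder x - A x', of order ρ, and the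
  -- 𝟏-part of A applied to `reduced x'`, of order r. Hence κ has to dominate both r and ρ.
  have hba : |x'.coeff 0 - x.coeff 0| ≤ 3 * C * D * κ := by
    have h0 : forestSize (0 : Forest d) < P := hP
    have h1 := abs_coeff_mul_le_truncNorm (hr := hr) (x - A x') h0
    have h2 := abs_coeff_mul_le_truncNorm (hr := hr) (A (reduced x')) h0
    rw [forestSize_zero, pow_zero, mul_one] at h1 h2
    have h3 : (x - A x').coeff 0 = x.coeff 0 - x'.coeff 0 - (A (reduced x')).coeff 0 := by
      rw [hAx]
      simp only [AddMonoidAlgebra.coeff_sub, AddMonoidAlgebra.coeff_add,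
        AddMonoidAlgebra.coeff_smul, Finsupp.sub_apply, Finsupp.add_apply, Finsupp.smul_apply,
        AddMonoidAlgebra.coeff_one_zero, smul_eq_mul, mul_one]
      ring
    have h4 : x'.coeff 0 - x.coeff 0 = -(x - A x').coeff 0 + -(A (reduced x')).coeff 0 := by
      rw [h3]; ring
    rw [h4]
    refine (abs_add_le _ _).trans ?_
    rw [abs_neg, abs_neg]
    have h5 : D * ρ ≤ C * D * κ := by
      have : D ≤ C * D := le_mul_of_one_le_left (by linarith) hC
      gcongr
    linarith
  -- The decomposition used is `reduced x` = A(`reduced x'`) + (b - a)𝟏 + (x - A x'), where a and b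
  -- are the 𝟏-coefficients of x and x'.
  have key := seminorm_taylorSum_sub_le (p := truncNorm d P hr) truncNorm_mul_le truncNorm_one_le
    hg (C := 3 * C * D) (by linarith) hB ((abs_coeff_le_l1Norm x 0).trans hx)
    ((abs_coeff_le_l1Norm x' 0).trans hx') hκ0 hκ1 hκρ (hρκ.trans hκ1) (x := reduced x)
    (z := A (reduced x')) (R := x - A x') (by
      rw [hAx, reduced, sub_smul]
      abel) (hz.trans (by
        have : 0 ≤ C * D * κ := by positivity
        linarith)) hba (hxx.trans (by
        have : D ≤ C * D := le_mul_of_one_le_left (by linarith) hC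
        have : D * ρ ≤ C * D * ρ := by gcongr
        have : 0 ≤ C * D * ρ := by positivity
        linarith))
  rwa [compose, compose, map_taylorSum]

/-- Products of a composition with a modelled distribution are modelled distributions. -/
theorem exists_truncNorm_compose_mul_sub_le (hP : 0 < P) {B C D : ℝ} (hC : 1 ≤ C) (hD : 1 ≤ D)
    {g : ℝ → ℝ} (hg : ContDiff ℝ P g)
    (hB : ∀ n ≤ P, ∀ y, |y| ≤ D → |iteratedDeriv n g y| ≤ B) :
    ∃ E : ℝ, 0 < E ∧ ∀ (A : ForestAlg d →ₐ[ℝ] ForestAlg d) {r κ ρ ε : ℝ} (hr : 0 ≤ r),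
      ScaledBound A P (P * P + P) hr C → r ≤ κ → ρ ≤ κ → κ ≤ 1 → κ ^ P ≤ ρ →
      ∀ x x' v v' : ForestAlg d, l1Norm d x ≤ D → l1Norm d x' ≤ D → x' ∈ sizeLE d P →
        v' ∈ sizeLE d P → truncNorm d P hr (x - A x') ≤ D * ρ →
        l1Norm d v ≤ ε → l1Norm d v' ≤ ε → truncNorm d P hr (v - A v') ≤ ε * ρ →
        truncNorm d P hr (compose g P x * v - A (trunc d P (compose g P x' * v'))) ≤
          E * ρ * ε := by
  have hB0 : 0 ≤ B := (abs_nonneg _).trans (hB 0 P.zero_le 0 (by simpa using by linarith))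
  set E₁ := P * (B * (P * (3 * (3 * C * D)) ^ P * (3 * C * D))) + P * (B * (3 * C * D) ^ P) with hE₁
  set E₂ := P * (B * (2 * C * D) ^ P) with hE₂
  set E₃ := P * (B * (2 * D) ^ P) with hE₃
  have h1 : 0 ≤ E₁ := by positivity
  have h2 : 0 ≤ E₂ := by positivity
  have h3 : 0 ≤ E₃ := by positivity
  refine ⟨1 + E₁ + E₂ + (1 + C) * E₃, by positivity, ?_⟩
  intro A r κ ρ ε hr hA hrκ hρκ hκ1 hκρ x x' v v' hx hx' hxP' hvP' hxx hv hv' hvv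
  have hκ0 : 0 ≤ κ := hr.trans hrκ
  have hρ0 : 0 ≤ ρ := (pow_nonneg hκ0 P).trans hκρ
  have hε0 : 0 ≤ ε := (apply_nonneg _ _).trans hv
  have hr1 : r ≤ 1 := hrκ.trans hκ1
  have hrP : r ^ P ≤ ρ := (pow_le_pow_left₀ hr hrκ P).trans hκρ
  -- Leibniz splitting, possible because A is multiplicative; the last summand is what truncation at
  -- the second base point removes. Each of the three pieces is linear in ε.
  have hsplit : compose g P x * v - A (trunc d P (compose g P x' * v')) =
      (compose g P x - A (compose g P x')) * v + A (compose g P x') * (v - A v') +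
        A (compose g P x' * v' - trunc d P (compose g P x' * v')) := by
    rw [map_sub A, map_mul A]
    ring
  have b1 : truncNorm d P hr ((compose g P x - A (compose g P x')) * v) ≤ E₁ * ρ * ε :=
    (truncNorm_mul_le _ _).trans (mul_le_mul
      (truncNorm_compose_sub_le hP (by omega) hA hC hrκ hρκ hκ1 hκρ hg hD hB hx hx' hxP' hxx)
      ((truncNorm_le_l1Norm hr1 v).trans hv) (apply_nonneg _ _) (by positivity))
  have b2 : truncNorm d P hr (A (compose g P x') * (v - A v')) ≤ E₂ * (ε * ρ) := by
    refine (truncNorm_mul_le _ _).trans (mul_le_mul ?_ hvv (apply_nonneg _ _) h2)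
    rw [compose, map_taylorSum]
    refine seminorm_taylorSum_le truncNorm_mul_le truncNorm_one_le ?_ ?_
      fun n hn => hB n hn _ ((abs_coeff_le_l1Norm x' 0).trans hx')
    · have : 1 ≤ C * D := one_le_mul_of_one_le_of_one_le hC hD
      linarith
    · refine (hA.le (by linarith) hr1 (sizeLE_mono (by omega) (reduced_mem_sizeLE hxP'))
        (m := 0) (AddMonoidAlgebra.mem_supported.2 fun _ _ => Nat.zero_le _)).trans ?_
      rw [pow_zero, mul_one]
      have : l1Norm d (reduced x') ≤ 2 * D := (l1Norm_reduced_le x').trans (by linarith)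
      calc C * l1Norm d (reduced x') ≤ C * (2 * D) := by gcongr
        _ = _ := by ring
  have b3 : truncNorm d P hr (A (compose g P x' * v' - trunc d P (compose g P x' * v'))) ≤
      C * ρ * (E₃ * ε) := by
    -- The untruncated composition lives on at most P · P vertices and v' on at most P, which is why
    -- the scaled bound is required up to P · P + P.
    refine (hA.sub_trunc_le (by linarith) hr1 (mul_mem_sizeLE
      (taylorSum_mem_sizeLE (reduced_mem_sizeLE hxP') _ _ _) hvP')).trans ?_
    have := (l1Norm_mul_le (compose g P x') v').trans (mul_le_mul (l1Norm_compose_le hD hB hx') hv'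
      (apply_nonneg _ _) h3)
    exact mul_le_mul (mul_le_mul_of_nonneg_left hrP (by linarith)) this (apply_nonneg _ _)
      (by positivity)
  rw [hsplit]
  refine (map_add_le_add _ _ _).trans ((add_le_add ((map_add_le_add _ _ _).trans
    (add_le_add b1 b2)) b3).trans ?_)
  have : 0 ≤ ρ * ε := by positivity
  have : 0 ≤ E₃ * (ρ * ε) := by positivity
  nlinarith

/-- The derivative of a composition along a line, up to terms of order `P`. -/
theorem hasDerivAt_compose {f : ℝ → ℝ} (hP : 0 < P) (hf : ContDiff ℝ P f) (x v : ForestAlg d)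
    (ℓ : ForestAlg d →ₗ[ℝ] ℝ) (hℓ : ∀ z ∈ sizeGE d P, ℓ z = 0) (θ : ℝ) :
    HasDerivAt (fun θ : ℝ => ℓ (compose f P (x + θ • v)))
      (ℓ (compose (deriv f) P (x + θ • v) * v)) θ := by
  have hz : reduced x + θ • reduced v ∈ sizeGE d 1 :=
    Submodule.add_mem _ (reduced_mem_sizeGE x) (Submodule.smul_mem _ _ (reduced_mem_sizeGE v))
  have h := hasDerivAt_taylorSum hf (x.coeff 0) (v.coeff 0) (reduced x) (reduced v) ℓ θ (hℓ _ (by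
    have := mul_mem_sizeGE (pow_mem_sizeGE hz (P - 1)) (reduced_mem_sizeGE v)
    rwa [Nat.sub_add_cancel hP] at this))
  have hc : ∀ (g : ℝ → ℝ) (θ : ℝ), compose g P (x + θ • v) =
      taylorSum g P (x.coeff 0 + θ * v.coeff 0) (reduced x + θ • reduced v) := by
    intro g θ
    rw [compose, reduced_add, reduced_smul]
    simp
  have hv : v.coeff 0 • 1 + reduced v = v := by rw [reduced]; abel
  simp only [hc]
  rwa [hv] at h

/-- Mean value inequality for the difference of the two lines, taken together so that cancellation
between the two base points is kept under the derivative. -/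
theorem abs_sub_le_of_compose {f : ℝ → ℝ} (hP : 0 < P) (hf : ContDiff ℝ P f)
    (x v x' v' : ForestAlg d) (ℓ ℓ' : ForestAlg d →ₗ[ℝ] ℝ) (hℓ : ∀ z ∈ sizeGE d P, ℓ z = 0)
    (hℓ' : ∀ z ∈ sizeGE d P, ℓ' z = 0) {c : ℝ}
    (h : ∀ θ ∈ Set.Icc (0 : ℝ) 1, |ℓ (compose (deriv f) P (x + θ • v) * v) -
      ℓ' (compose (deriv f) P (x' + θ • v') * v')| ≤ c) :
    |ℓ (compose f P (x + v) - compose f P x) - ℓ' (compose f P (x' + v') - compose f P x')| ≤ c := by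
  have hd : ∀ θ : ℝ, HasDerivAt
      (fun θ : ℝ => ℓ (compose f P (x + θ • v)) - ℓ' (compose f P (x' + θ • v')))
      (ℓ (compose (deriv f) P (x + θ • v) * v) - ℓ' (compose (deriv f) P (x' + θ • v') * v')) θ :=
    fun θ => (hasDerivAt_compose hP hf x v ℓ hℓ θ).sub (hasDerivAt_compose hP hf x' v' ℓ' hℓ' θ)
  have := (convex_Icc (0 : ℝ) 1).norm_image_sub_le_of_norm_hasDerivWithin_le
    (fun θ _ => (hd θ).hasDerivWithinAt) h (Set.left_mem_Icc.2 zero_le_one)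
    (Set.right_mem_Icc.2 zero_le_one)
  simp only [one_smul, zero_smul, add_zero, sub_zero, norm_one, mul_one, Real.norm_eq_abs] at this
  refine (le_of_eq ?_).trans this
  rw [map_sub, map_sub]
  congr 1
  ring

end Composition

end BranchedRS

/-! ### Composition with smooth functions on the branched rough path regularity structure -/

namespace BranchedRS

section Main

variable {d : ℕ} {γ α : ℝ}

theorem mulXi_ofForest (i : Fin d) (ζ : Forest d) :
    mulXi i (ofForest ζ) = Finsupp.single (.noise ζ i) 1 := by
  rw [mulXi, linExt_ofForest]

theorem homNorm_single_le {S : Type} {deg : S → ℝ} (σ : S) :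
    homNorm deg (deg σ) (Finsupp.single σ 1) ≤ 1 := by
  classical
  have := homNorm_le_card_mul (deg := deg) (β := deg σ) (x := Finsupp.single σ 1) {σ} zero_le_one
    (fun τ _ hτ => by
      by_contra h
      rw [Finset.mem_singleton] at h
      exact hτ (Finsupp.single_eq_of_ne h))
    (fun τ _ => by rw [Finsupp.single_apply]; split_ifs <;> simp)
  simpa using this

/-- The bounds of a model control the action on the forest algebra in the scaled norms. -/
theorem exists_scaledBound (hγ : 0 < γ) (M : BranchedModel d γ) (i : Fin d) {K : Set ℝ} (hK : IsCompact K)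
    (P Q : ℕ) : ∃ C : ℝ, 1 ≤ C ∧ ∀ t ∈ K, ∀ s ∈ K, 0 < dist t s →
      ∀ g, structAction g = M.Gam t s → ∀ hr : 0 ≤ dist t s ^ γ,
        ScaledBound (charAction g) P Q hr C := by
  -- The noise symbols see all forests, whereas ⟨𝒴⟩ sees only trees; the model bounds are therefore
  -- used on ζ Ξ_i, for finitely many ζ.
  choose c hc using fun ζ : Forest d =>
    M.isBimap.bound K hK (homogeneity γ (.noise ζ i)) ⟨_, rfl⟩
  have hnn : ∀ ζ : Forest d, 0 ≤ (smallForests d P).card * (1 + |c ζ|) := fun ζ => by positivity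
  refine ⟨1 + ∑ ζ ∈ smallForests d (Q + 1), (smallForests d P).card * (1 + |c ζ|), ?_, ?_⟩
  · have := Finset.sum_nonneg fun ζ (_ : ζ ∈ smallForests d (Q + 1)) => hnn ζ
    linarith
  intro t ht s hs h0 g hg hr ζ hζ
  have hle : (smallForests d P).card * (1 + |c ζ|) ≤
      1 + ∑ ζ ∈ smallForests d (Q + 1), (smallForests d P).card * (1 + |c ζ|) := by
    have := Finset.single_le_sum (fun ζ _ => hnn ζ) (mem_smallForests.2 (Nat.lt_succ_of_le hζ))
    linarith
  refine le_trans ?_ (mul_le_mul_of_nonneg_right hle (pow_nonneg hr _))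
  rw [mul_assoc]
  refine truncNorm_le_card_mul _ fun ξ _ => ?_
  -- By unitriangularity, forests ξ at least as large as ζ contribute only ζ itself, with
  -- coefficient 1. For smaller ξ the bound on Γ gives r^(|ζ|-|ξ|), and the weight r^|ξ| completes
  -- it to r^|ζ|.
  rcases le_or_gt (forestSize ζ) (forestSize ξ) with h | h
  · rw [coeff_charAction_ofForest g h]
    by_cases hξ : ζ = ξ
    · subst hξ
      have : (ofForest ζ).coeff ζ = 1 := by simp [ofForest]
      rw [this, abs_one]
      gcongr
      linarith [abs_nonneg (c ζ)]
    · have : (ofForest ζ).coeff ξ = 0 := by simp [ofForest, hξ]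
      rw [this, abs_zero, zero_mul]
      positivity
  · have hcoef : (charAction g (ofForest ζ)).coeff ξ =
        M.Gam t s (Finsupp.single (.noise ζ i) 1) (.noise ξ i) := by
      rw [← hg, ← mulXi_ofForest, structAction_mulXi, mulXi_noise]
    have hlt : homogeneity γ (.noise ξ i) < homogeneity γ (.noise ζ i) := by
      have : γ * forestSize ξ < γ * forestSize ζ := by gcongr
      simp only [homogeneity]
      linarith
    have hdiff : homogeneity γ (.noise ζ i) - homogeneity γ (.noise ξ i) =
        γ * (forestSize ζ - forestSize ξ) := by
      simp only [homogeneity]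
      ring
    have hmem : (Finsupp.single (.noise ζ i) 1 : ModelSpace d) ∈
        homog (homogeneity γ) (homogeneity γ (.noise ζ i)) :=
      Finsupp.single_mem_supported ℝ 1 rfl
    have hb := hc ζ t ht s hs _ hmem (homogeneity γ (.noise ξ i)) ⟨_, rfl⟩ hlt
    have hpow : dist t s ^ (γ * ((forestSize ζ : ℝ) - forestSize ξ)) *
        (dist t s ^ γ) ^ forestSize ξ = (dist t s ^ γ) ^ forestSize ζ := by
      rw [← Real.rpow_natCast, ← Real.rpow_natCast, ← Real.rpow_mul h0.le, ← Real.rpow_mul h0.le,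
        ← Real.rpow_add h0]
      congr 1
      ring
    rw [hdiff] at hb
    have hh : 0 ≤ dist t s ^ (γ * ((forestSize ζ : ℝ) - forestSize ξ)) :=
      (Real.rpow_pos_of_pos h0 _).le
    have h2 : c ζ * homNorm (homogeneity γ) (homogeneity γ (.noise ζ i))
        (Finsupp.single (Sym.noise ζ i) 1) ≤ 1 + |c ζ| := by
      have h3 := homNorm_single_le (deg := homogeneity γ) (Sym.noise ζ i)
      have h4 := homNorm_nonneg (deg := homogeneity γ) (homogeneity γ (.noise ζ i))
        (Finsupp.single (Sym.noise ζ i) 1)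
      have h5 := mul_le_mul (le_abs_self (c ζ)) h3 h4 (abs_nonneg _)
      linarith
    rw [hcoef, ← hpow, ← mul_assoc]
    refine mul_le_mul_of_nonneg_right ?_ (pow_nonneg hr _)
    exact (abs_apply_le_homNorm (deg := homogeneity γ) _ _).trans
      (hb.trans (mul_le_mul_of_nonneg_right h2 hh))

/-! ### Dictionary between homogeneities and vertex numbers -/

theorem mul_lt_iff_lt_ceil (hγ : 0 < γ) (n : ℕ) : γ * n < α ↔ n < ⌈α / γ⌉₊ := by
  rw [Nat.lt_ceil, lt_div_iff₀ hγ, mul_comm]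

theorem toForestAlg_sub_unit (y : ModelSpace d) :
    toForestAlg (y - Finsupp.single .unit (unitCoeff y)) = reduced (toForestAlg y) := by
  have h : Finsupp.single (.unit : Sym d) (unitCoeff y) =
      unitCoeff y • Finsupp.single (.unit : Sym d) 1 := by simp
  rw [map_sub, h, map_smul, toForestAlg_unit, reduced, coeff_toForestAlg_zero]
  rfl

/-- The shift by γ - 1 is common to the homogeneity of ζ Ξ_i and to the cutoff, so it cancels and
leaves γ|ζ| < α. -/
theorem projBelow_mulXi (hγ : 0 < γ) (i : Fin d) (x : ForestAlg d) :
    projBelow (homogeneity γ) (α + γ - 1) (mulXi i x) = mulXi i (trunc d ⌈α / γ⌉₊ x) := by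
  classical
  ext σ
  simp only [projBelow, Finsupp.filter_apply]
  by_cases hσ : ∃ ζ, σ = .noise ζ i
  · obtain ⟨ζ, rfl⟩ := hσ
    have hiff : homogeneity γ (.noise ζ i) < α + γ - 1 ↔ forestSize ζ < ⌈α / γ⌉₊ := by
      rw [← mul_lt_iff_lt_ceil hγ]
      simp only [homogeneity]
      constructor <;> intro h <;> linarith
    rw [mulXi_noise, mulXi_noise]
    split_ifs with h
    · rw [coeff_trunc (hiff.1 h)]
    · rw [coeff_trunc_eq_zero (fun h' => h (hiff.2 h'))]
  · have h : ∀ ζ, σ ≠ .noise ζ i := fun ζ h => hσ ⟨ζ, h⟩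
    rw [mulXi_eq_zero i _ h, mulXi_eq_zero i _ h, ite_self]

theorem taylorLift_eq (hγ : 0 < γ) (f : ℝ → ℝ) (i : Fin d) (y : ModelSpace d) :
    taylorLift γ α f i y =
      mulXi i (trunc d ⌈α / γ⌉₊ (compose f ⌈α / γ⌉₊ (toForestAlg y))) := by
  have hterm : ∀ n : ℕ, projBelow (homogeneity γ) (α + γ - 1)
      ((iteratedDeriv n f (unitCoeff y) / (n.factorial : ℝ)) •
        mulXi i (toForestAlg (y - Finsupp.single .unit (unitCoeff y)) ^ n)) =
      mulXi i (trunc d ⌈α / γ⌉₊ ((iteratedDeriv n f ((toForestAlg y).coeff 0) /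
        (n.factorial : ℝ)) • reduced (toForestAlg y) ^ n)) := by
    intro n
    rw [toForestAlg_sub_unit, ← map_smul, projBelow_mulXi hγ, coeff_toForestAlg_zero]
    rfl
  -- The defining sum has ⌊α/γ⌋ + 1 terms, one more than ⌈α/γ⌉ exactly when α/γ is an integer. The
  -- extra power then has at least ⌈α/γ⌉ vertices and is truncated away.
  have hP : ⌈α / γ⌉₊ ≤ ⌊α / γ⌋₊ + 1 := Nat.ceil_le_floor_add_one _
  rw [taylorLift, compose, taylorSum, map_sum, map_sum]
  refine (Finset.sum_congr rfl fun n _ => hterm n).trans (Finset.sum_subset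
    (Finset.range_subset_range.2 hP) fun n _ hn => ?_).symm
  rw [trunc_eq_zero, map_zero]
  refine Submodule.smul_mem _ _ (sizeGE_anti ?_ (pow_mem_sizeGE (reduced_mem_sizeGE _) n))
  simpa using hn

theorem mulXi_trunc_mem (hγ : 0 < γ) (i : Fin d) (x : ForestAlg d) :
    mulXi i (trunc d ⌈α / γ⌉₊ x) ∈ sectorYdot d ⊓ below (homogeneity γ) (α + γ - 1) := by
  refine ⟨(Finsupp.mem_supported' ℝ _).2 fun σ hσ => mulXi_eq_zero i _ fun ζ h => hσ ⟨ζ, i, h⟩,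
    (Finsupp.mem_supported' ℝ _).2 fun σ hσ => ?_⟩
  by_cases h : ∃ ζ, σ = .noise ζ i
  · obtain ⟨ζ, rfl⟩ := h
    rw [mulXi_noise, coeff_trunc_eq_zero]
    rw [← mul_lt_iff_lt_ceil hγ]
    intro h
    refine hσ ?_
    change homogeneity γ (.noise ζ i) < α + γ - 1
    simp only [homogeneity]
    linarith
  · exact mulXi_eq_zero i _ fun ζ h' => h ⟨ζ, h'⟩

theorem coeff_toForestAlg_of_mem_below (hγ : 0 < γ) {y : ModelSpace d}
    (hy : y ∈ below (homogeneity γ) α) {ζ : Forest d} (hζ : ¬ forestSize ζ < ⌈α / γ⌉₊) :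
    (toForestAlg y).coeff ζ = 0 := by
  rcases coeff_toForestAlg_cases γ y ζ with h | ⟨σ, hσ, h⟩
  · exact h
  · rw [h]
    refine (Finsupp.mem_supported' ℝ y).1 hy σ fun hlt => hζ ?_
    rw [← mul_lt_iff_lt_ceil hγ, ← hσ]
    exact hlt

theorem toForestAlg_mem_sizeLE (hγ : 0 < γ) {y : ModelSpace d}
    (hy : y ∈ below (homogeneity γ) α) : toForestAlg y ∈ sizeLE d ⌈α / γ⌉₊ :=
  AddMonoidAlgebra.mem_supported'.2 fun _ hζ => coeff_toForestAlg_of_mem_below hγ hy fun h =>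
    hζ (le_of_lt (α := ℕ) h)

theorem l1Norm_toForestAlg_le (hγ : 0 < γ) {y : ModelSpace d}
    (hy : y ∈ below (homogeneity γ) α) {c : ℝ} (hc : 0 ≤ c)
    (h : ∀ σ : Sym d, homogeneity γ σ < α → |y σ| ≤ c) :
    l1Norm d (toForestAlg y) ≤ (smallForests d ⌈α / γ⌉₊).card * c := by
  refine l1Norm_le_card_mul (fun ζ hζ => coeff_toForestAlg_of_mem_below hγ hy hζ) fun ζ => ?_
  by_cases hζ : forestSize ζ < ⌈α / γ⌉₊
  · rcases coeff_toForestAlg_cases γ y ζ with h0 | ⟨σ, hσ, h0⟩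
    · simpa [h0] using hc
    · rw [h0]
      exact h σ (by rwa [hσ, mul_lt_iff_lt_ceil hγ])
  · simpa [coeff_toForestAlg_of_mem_below hγ hy hζ] using hc

theorem rpow_sub_mul_pow {h : ℝ} (h0 : 0 < h) (n : ℕ) : h ^ (α - γ * n) * (h ^ γ) ^ n = h ^ α := by
  rw [← Real.rpow_natCast, ← Real.rpow_mul h0.le, ← Real.rpow_add h0, sub_add_cancel]

/-- The weight h^(γ|ζ|) cancels the loss in h^(α-γ|ζ|), so the graded family of increment bounds
collapses to the single order h^α. -/
theorem truncNorm_toForestAlg_le (hγ : 0 < γ) {y : ModelSpace d} {h c : ℝ} (h0 : 0 < h)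
    (hc : 0 ≤ c) (hr : 0 ≤ h ^ γ)
    (hy : ∀ σ : Sym d, homogeneity γ σ < α → |y σ| ≤ c * h ^ (α - homogeneity γ σ)) :
    truncNorm d ⌈α / γ⌉₊ hr (toForestAlg y) ≤ (smallForests d ⌈α / γ⌉₊).card * (c * h ^ α) := by
  refine truncNorm_le_card_mul _ fun ζ hζ => ?_
  rcases coeff_toForestAlg_cases γ y ζ with h1 | ⟨σ, hσ, h1⟩
  · rw [h1, abs_zero, zero_mul]
    exact mul_nonneg hc (Real.rpow_nonneg h0.le _)
  · have := hy σ (by rwa [hσ, mul_lt_iff_lt_ceil hγ])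
    rw [hσ] at this
    rw [h1, ← rpow_sub_mul_pow (α := α) (γ := γ) h0 (forestSize ζ), ← mul_assoc]
    exact mul_le_mul_of_nonneg_right this (pow_nonneg hr _)

theorem homNorm_mulXi_le (hγ : 0 < γ) (i : Fin d) (x : ForestAlg d) {β c : ℝ} (hc : 0 ≤ c)
    (hβ : β < α + γ - 1)
    (h : ∀ ζ : Forest d, forestSize ζ < ⌈α / γ⌉₊ → γ * forestSize ζ + γ - 1 = β →
      |x.coeff ζ| ≤ c) :
    homNorm (homogeneity γ) β (mulXi i x) ≤ (smallForests d ⌈α / γ⌉₊).card * c := by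
  classical
  have hsize : ∀ ζ : Forest d, γ * forestSize ζ + γ - 1 = β → forestSize ζ < ⌈α / γ⌉₊ := by
    intro ζ hζ
    rw [← mul_lt_iff_lt_ceil hγ]
    linarith
  refine (homNorm_le_card_mul ((smallForests d ⌈α / γ⌉₊).image fun ζ => .noise ζ i) hc
    (fun σ hσ hne => ?_) fun σ hσ => ?_).trans (mul_le_mul_of_nonneg_right
      (by exact_mod_cast Finset.card_image_le) hc)
  · by_cases h' : ∃ ζ, σ = .noise ζ i
    · obtain ⟨ζ, rfl⟩ := h'
      exact Finset.mem_image.2 ⟨ζ, mem_smallForests.2 (hsize ζ hσ), rfl⟩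
    · exact absurd (mulXi_eq_zero i x fun ζ hζ => h' ⟨ζ, hζ⟩) hne
  · by_cases h' : ∃ ζ, σ = .noise ζ i
    · obtain ⟨ζ, rfl⟩ := h'
      rw [mulXi_noise]
      exact h ζ (hsize ζ hσ) hσ
    · rw [mulXi_eq_zero i x fun ζ hζ => h' ⟨ζ, hζ⟩, abs_zero]
      exact hc

theorem exists_iteratedDeriv_bound {g : ℝ → ℝ} {P : ℕ} (hg : ContDiff ℝ P g) (D : ℝ) :
    ∃ B : ℝ, ∀ n ≤ P, ∀ y, |y| ≤ D → |iteratedDeriv n g y| ≤ B := by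
  have h : ∀ n : ℕ, ∃ b : ℝ, n ≤ P → ∀ y, |y| ≤ D → |iteratedDeriv n g y| ≤ b := by
    intro n
    by_cases hn : n ≤ P
    · obtain ⟨b, hb⟩ := (isCompact_Icc (a := -D) (b := D)).exists_bound_of_continuousOn
        (hg.continuous_iteratedDeriv n (by exact_mod_cast hn)).continuousOn
      exact ⟨b, fun _ y hy => hb y (abs_le.1 hy)⟩
    · exact ⟨0, fun h => absurd h hn⟩
  choose b hb using h
  refine ⟨∑ n ∈ Finset.range (P + 1), |b n|, fun n hn y hy => (hb n hn y hy).trans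
    ((le_abs_self _).trans ?_)⟩
  exact Finset.single_le_sum (f := fun n => |b n|) (fun _ _ => abs_nonneg _)
    (Finset.mem_range.2 (Nat.lt_succ_of_le hn))

theorem seminorm_line_le {H : Type*} [AddCommGroup H] [Module ℝ H] (q : Seminorm ℝ H) {x y : H}
    {c : ℝ} (hx : q x ≤ c) (hy : q y ≤ c) {θ : ℝ} (hθ : θ ∈ Set.Icc (0 : ℝ) 1) :
    q (x + θ • (y - x)) ≤ c := by
  have h : x + θ • (y - x) = (1 - θ) • x + θ • y := by module
  rw [h]
  refine (map_add_le_add _ _ _).trans ?_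
  rw [map_smul_eq_mul, map_smul_eq_mul, Real.norm_of_nonneg hθ.1,
    Real.norm_of_nonneg (sub_nonneg.2 hθ.2)]
  nlinarith [hθ.1, hθ.2]

/-- The coefficient of a forest as a linear functional. -/
noncomputable def coeffFunctional (ζ : Forest d) : ForestAlg d →ₗ[ℝ] ℝ :=
  Finsupp.lapply ζ ∘ₗ (AddMonoidAlgebra.coeffLinearEquiv ℝ).toLinearMap

theorem coeffFunctional_apply (ζ : Forest d) (x : ForestAlg d) :
    coeffFunctional ζ x = x.coeff ζ := rfl

/-- The local Lipschitz bound for `Y ↦ f(Y) Ξ_i`. -/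
theorem exists_mdNorm_taylorLift_sub_le (hγ : 0 < γ) (hα : 0 < α) {f : ℝ → ℝ}
    (hf : ContDiff ℝ (⌈α / γ⌉₊ + 1 : ℕ) f) (M : BranchedModel d γ) (i : Fin d) {K : Set ℝ}
    (hK : IsCompact K) {D : ℝ} (hD : 0 < D) :
    ∃ C : ℝ, 0 < C ∧ ∀ F G : ℝ → ModelSpace d, (∀ t, F t ∈ below (homogeneity γ) α) →
      (∀ t, G t ∈ below (homogeneity γ) α) →
      mdNorm (homogeneity γ) M.Gam α K F + mdNorm (homogeneity γ) M.Gam α K G ≤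
        ENNReal.ofReal D →
      mdNorm (homogeneity γ) M.Gam (α + γ - 1) K
          (fun t => taylorLift γ α f i (F t) - taylorLift γ α f i (G t)) ≤
        ENNReal.ofReal C * mdNorm (homogeneity γ) M.Gam α K (fun t => F t - G t) := by
  have hP : 0 < ⌈α / γ⌉₊ := Nat.ceil_pos.2 (div_pos hα hγ)
  have hαP : α ≤ γ * ⌈α / γ⌉₊ := by
    have := Nat.le_ceil (α / γ)
    rwa [div_le_iff₀ hγ, mul_comm] at this
  have hlift := taylorLift_eq (α := α) hγ f i
  set N : ℝ := ((smallForests d ⌈α / γ⌉₊).card : ℝ)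
  have hN0 : 0 ≤ N := Nat.cast_nonneg _
  have hf' : ContDiff ℝ ⌈α / γ⌉₊ (deriv f) := by
    have : ContDiff ℝ ((⌈α / γ⌉₊ : WithTop ℕ∞) + 1) f := by exact_mod_cast hf
    exact (contDiff_succ_iff_deriv.1 this).2.2
  have hf0 : ContDiff ℝ ⌈α / γ⌉₊ f := hf.of_le (by exact_mod_cast Nat.le_succ _)
  have hD' : 1 ≤ 1 + N * D := by
    have : 0 ≤ N * D := by positivity
    linarith
  obtain ⟨B, hB⟩ := exists_iteratedDeriv_bound hf' (1 + N * D)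
  have hB0 : 0 ≤ B := (abs_nonneg _).trans (hB 0 (Nat.zero_le _) 0 (by simp; positivity))
  -- One constant serves all pairs of points of K and all forests that can occur in the untruncated
  -- products below.
  obtain ⟨C, hC, hA⟩ := exists_scaledBound hγ M i hK ⌈α / γ⌉₊ (⌈α / γ⌉₊ * ⌈α / γ⌉₊ + ⌈α / γ⌉₊)
  obtain ⟨E, hE, hEb⟩ := exists_truncNorm_compose_mul_sub_le (d := d) hP hC hD' hf' hB
  set E' : ℝ := ⌈α / γ⌉₊ * (B * (2 * (1 + N * D)) ^ ⌈α / γ⌉₊)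
  have hE'0 : 0 ≤ E' := by positivity
  -- E' comes from the pointwise part and E from the increments. The inner N converts the modelled
  -- distribution norm into the forest norms, the outer N converts back, and 1 ensures positivity.
  refine ⟨1 + (N * (E' * N) + N * (E * N)), by positivity, ?_⟩
  intro F G hF hG hFG
  have hdiff := (mdNorm_sub_le (deg := homogeneity γ) (Γ := M.Gam) (η := α) (K := K) F G).trans hFG
  obtain ⟨ε, hε0, hεeq⟩ : ∃ ε : ℝ, 0 ≤ ε ∧
      mdNorm (homogeneity γ) M.Gam α K (fun t => F t - G t) = ENNReal.ofReal ε :=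
    ⟨_, ENNReal.toReal_nonneg,
      (ENNReal.ofReal_toReal (hdiff.trans_lt ENNReal.ofReal_lt_top).ne).symm⟩
  have hl1 : ∀ {H : ℝ → ModelSpace d} {c : ℝ}, 0 ≤ c → (∀ t, H t ∈ below (homogeneity γ) α) →
      mdNorm (homogeneity γ) M.Gam α K H ≤ ENNReal.ofReal c → ∀ t ∈ K,
      l1Norm d (toForestAlg (H t)) ≤ N * c := by
    intro H c hc hH hHc t ht
    refine l1Norm_toForestAlg_le hγ (hH t) hc fun σ hσ => ?_
    exact (abs_apply_le_homNorm (deg := homogeneity γ) _ σ).trans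
      (homNorm_le_of_mdNorm_le hc hHc ht ⟨σ, rfl⟩ hσ)
  have hinc : ∀ {H : ℝ → ModelSpace d} {c : ℝ}, 0 ≤ c →
      mdNorm (homogeneity γ) M.Gam α K H ≤ ENNReal.ofReal c → ∀ t ∈ K, ∀ s ∈ K, 0 < dist t s →
      dist t s ≤ 1 → ∀ g, structAction g = M.Gam t s → ∀ hr : 0 ≤ dist t s ^ γ,
      truncNorm d ⌈α / γ⌉₊ hr (toForestAlg (H t) - charAction g (toForestAlg (H s))) ≤
        N * c * dist t s ^ α := by
    intro H c hc hHc t ht s hs h0 h1 g hg hr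
    rw [← toForestAlg_structAction, hg, ← map_sub, mul_assoc]
    refine truncNorm_toForestAlg_le hγ h0 hc hr fun σ hσ => ?_
    exact (abs_apply_le_homNorm (deg := homogeneity γ) _ σ).trans
      (homNorm_sub_le_of_mdNorm_le hc hHc ht hs h0 h1 ⟨σ, rfl⟩ hσ)
  have hFD := (le_self_add.trans hFG : mdNorm (homogeneity γ) M.Gam α K F ≤ _)
  have hGD := (le_add_self.trans hFG : mdNorm (homogeneity γ) M.Gam α K G ≤ _)
  have hsub : ∀ t, toForestAlg (G t) + toForestAlg (F t - G t) = toForestAlg (F t) := fun t => by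
    rw [← map_add, add_sub_cancel]
  have hline1 : ∀ t ∈ K, ∀ θ ∈ Set.Icc (0 : ℝ) 1,
      l1Norm d (toForestAlg (G t) + θ • toForestAlg (F t - G t)) ≤ 1 + N * D := by
    intro t ht θ hθ
    rw [map_sub]
    refine (seminorm_line_le _ (hl1 hD.le hG hGD t ht) (hl1 hD.le hF hFD t ht) hθ).trans ?_
    linarith
  have hv : ∀ t ∈ K, l1Norm d (toForestAlg (F t - G t)) ≤ N * ε := fun t ht =>
    hl1 (H := fun t => F t - G t) hε0 (fun t => Submodule.sub_mem _ (hF t) (hG t)) hεeq.le t ht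
  have hkill : ∀ ζ : Forest d, forestSize ζ < ⌈α / γ⌉₊ → ∀ z ∈ sizeGE d ⌈α / γ⌉₊,
      coeffFunctional ζ z = 0 := fun ζ hζ z hz => coeff_eq_zero_of_mem_sizeGE hz hζ
  have hfinal : ENNReal.ofReal (N * (E' * (N * ε))) + ENNReal.ofReal (N * (E * (N * ε))) ≤
      ENNReal.ofReal (1 + (N * (E' * N) + N * (E * N))) *
        mdNorm (homogeneity γ) M.Gam α K (fun t => F t - G t) := by
    rw [hεeq, ← ENNReal.ofReal_add (by positivity) (by positivity),
      ← ENNReal.ofReal_mul (by positivity)]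
    refine ENNReal.ofReal_le_ofReal ?_
    nlinarith
  refine (mdNorm_le (fun t ht β _ hβ => ENNReal.ofReal_le_ofReal ?_)
    fun t ht s hs h0 h1 β _ hβ => ENNReal.ofReal_le_ofReal ?_).trans hfinal
  · rw [hlift, hlift, ← map_sub, ← map_sub]
    refine homNorm_mulXi_le hγ i _ (by positivity) hβ fun ζ hζ _ => ?_
    -- The pointwise bound is the case in which the second functional is zero.
    have := abs_sub_le_of_compose hP hf0 (toForestAlg (G t)) (toForestAlg (F t - G t)) 0 0
      (coeffFunctional ζ) 0 (hkill ζ hζ) (fun _ _ => rfl) (c := E' * (N * ε)) fun θ hθ => by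
        rw [LinearMap.zero_apply, sub_zero, coeffFunctional_apply]
        refine (abs_coeff_le_l1Norm _ ζ).trans ((l1Norm_mul_le _ _).trans ?_)
        exact mul_le_mul (l1Norm_compose_le hD' hB (hline1 t ht θ hθ)) (hv t ht)
          (apply_nonneg _ _) hE'0
    rw [LinearMap.zero_apply, sub_zero, hsub t] at this
    rwa [coeff_trunc hζ]
  · obtain ⟨g, hg⟩ := M.isBimap.mem t s
    have hpos : 0 < dist t s ^ (α + γ - 1 - β) := Real.rpow_pos_of_pos h0 _
    rw [div_le_iff₀ hpos, hlift, hlift, hlift, hlift, ← map_sub, ← map_sub, ← map_sub, ← map_sub,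
      ← hg, structAction_mulXi, ← map_sub, mul_assoc]
    refine homNorm_mulXi_le hγ i _ (by positivity) hβ fun ζ hζ hζβ => ?_
    have hr : 0 ≤ dist t s ^ γ := (Real.rpow_pos_of_pos h0 _).le
    have hrn : 0 < (dist t s ^ γ) ^ forestSize ζ := pow_pos (Real.rpow_pos_of_pos h0 _) _
    have hρ1 : dist t s ^ α ≤ 1 := Real.rpow_le_one h0.le h1 hα.le
    have hr1 : dist t s ^ γ ≤ 1 := Real.rpow_le_one h0.le h1 hγ.le
    have hρ0 : 0 ≤ dist t s ^ α := (Real.rpow_pos_of_pos h0 _).le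
    -- If α ≥ γ the maximum is h^γ and γ⌈α/γ⌉ ≥ α suffices; if α < γ it is h^α, and a positive power
    -- of a number in [0, 1] does not exceed it.
    have hκρ : max (dist t s ^ γ) (dist t s ^ α) ^ ⌈α / γ⌉₊ ≤ dist t s ^ α := by
      rcases le_total (dist t s ^ γ) (dist t s ^ α) with h | h
      · rw [max_eq_right h]
        exact pow_le_of_le_one hρ0 hρ1 hP.ne'
      · rw [max_eq_left h, ← Real.rpow_natCast, ← Real.rpow_mul h0.le]
        exact Real.rpow_le_rpow_of_exponent_ge h0 h1 hαP
    have hexp : α + γ - 1 - β = α - γ * forestSize ζ := by rw [← hζβ]; ring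
    have hF1 := hinc hD.le hFD t ht s hs h0 h1 g hg hr
    have hG1 := hinc hD.le hGD t ht s hs h0 h1 g hg hr
    have hV1 := hinc (H := fun t => F t - G t) hε0 hεeq.le t ht s hs h0 h1 g hg hr
    -- The second functional re-expands the truncated lift from s to t and reads off ζ. It vanishes
    -- on forests with at least ⌈α/γ⌉ vertices because of `trunc`; the first needs no truncation,
    -- since ζ is small.
    have := abs_sub_le_of_compose hP hf0 (toForestAlg (G t)) (toForestAlg (F t - G t))
      (toForestAlg (G s)) (toForestAlg (F s - G s)) (coeffFunctional ζ)
      (coeffFunctional ζ ∘ₗ (charAction g).toLinearMap ∘ₗ trunc d ⌈α / γ⌉₊) (hkill ζ hζ)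
      (fun z hz => by simp only [LinearMap.comp_apply, trunc_eq_zero hz, map_zero])
      (c := E * (N * ε) * dist t s ^ (α + γ - 1 - β)) fun θ hθ => by
        have hb := hEb (charAction g) (κ := max (dist t s ^ γ) (dist t s ^ α))
          (ρ := dist t s ^ α) (ε := N * ε) hr (hA t ht s hs h0 g hg hr) (le_max_left _ _)
          (le_max_right _ _) (max_le hr1 hρ1) hκρ
          (toForestAlg (G t) + θ • toForestAlg (F t - G t))
          (toForestAlg (G s) + θ • toForestAlg (F s - G s)) (toForestAlg (F t - G t))
          (toForestAlg (F s - G s)) (hline1 t ht θ hθ) (hline1 s hs θ hθ)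
          (Submodule.add_mem _ (toForestAlg_mem_sizeLE hγ (hG s)) (Submodule.smul_mem _ _
            (toForestAlg_mem_sizeLE hγ (Submodule.sub_mem _ (hF s) (hG s)))))
          (toForestAlg_mem_sizeLE hγ (Submodule.sub_mem _ (hF s) (hG s))) (by
            have heq : toForestAlg (G t) + θ • toForestAlg (F t - G t) -
                charAction g (toForestAlg (G s) + θ • toForestAlg (F s - G s)) =
                (toForestAlg (G t) - charAction g (toForestAlg (G s))) +
                θ • ((toForestAlg (F t) - charAction g (toForestAlg (F s))) -
                  (toForestAlg (G t) - charAction g (toForestAlg (G s)))) := by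
              simp only [map_add, map_sub, map_smul]
              module
            rw [heq]
            -- The increment of the interpolation is the interpolation of the increments of G and F,
            -- so convexity gives a bound uniform in θ.
            refine (seminorm_line_le _ hG1 hF1 hθ).trans ?_
            gcongr
            linarith) (hv t ht) (hv s hs) hV1
        simp only [LinearMap.comp_apply, AlgHom.toLinearMap_apply]
        rw [← map_sub, coeffFunctional_apply]
        -- Multiplying by r^|ζ| passes to the scaled norm; dividing it out of h^α leaves h^(α-γ|ζ|),
        -- the required power at this homogeneity.
        refine le_of_mul_le_mul_right ?_ hrn
        refine (abs_coeff_mul_le_truncNorm (hr := hr) _ hζ).trans (hb.trans (le_of_eq ?_))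
        rw [mul_assoc _ (dist t s ^ (α + γ - 1 - β)), hexp, rpow_sub_mul_pow h0]
        ring
    rw [hsub t, hsub s] at this
    simp only [LinearMap.comp_apply, AlgHom.toLinearMap_apply, coeffFunctional_apply] at this
    rwa [AddMonoidAlgebra.coeff_sub, Finsupp.sub_apply, coeff_trunc hζ, ← mul_assoc,
      mul_assoc E N]

/-- The composition of the zero function is bounded. -/
theorem mdNorm_taylorLift_zero_lt_top (hγ : 0 < γ) (hα : 0 < α) (f : ℝ → ℝ)
    (M : BranchedModel d γ) (i : Fin d) (K : Set ℝ) :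
    mdNorm (homogeneity γ) M.Gam (α + γ - 1) K (fun _ => taylorLift γ α f i 0) < ⊤ := by
  have hP : 0 < ⌈α / γ⌉₊ := Nat.ceil_pos.2 (div_pos hα hγ)
  have hone : ofForest (0 : Forest d) = 1 := rfl
  have hlift : taylorLift γ α f i 0 = mulXi i (f 0 • 1) := by
    rw [taylorLift_eq hγ, map_zero, compose]
    have h0 : reduced (0 : ForestAlg d) = 0 := by simp [reduced]
    have h1 : taylorSum f ⌈α / γ⌉₊ ((0 : ForestAlg d).coeff 0) (0 : ForestAlg d) = f 0 • 1 := by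
      rw [taylorSum, Finset.sum_eq_single_of_mem 0 (Finset.mem_range.2 hP)
        fun n _ hn => by rw [zero_pow hn, smul_zero]]
      simp
    rw [h0, h1, map_smul, ← hone, trunc, linExt_ofForest, if_pos (by rwa [forestSize_zero])]
  refine (mdNorm_le (c₁ := ENNReal.ofReal ((smallForests d ⌈α / γ⌉₊).card * |f 0|)) (c₂ := 0)
    (fun t _ β _ hβ => ENNReal.ofReal_le_ofReal ?_) fun t _ s _ h0 _ β _ _ => ?_).trans_lt
    (by rw [add_zero]; exact ENNReal.ofReal_lt_top)
  · rw [hlift]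
    refine homNorm_mulXi_le hγ i _ (abs_nonneg _) hβ fun ζ _ _ => ?_
    rw [AddMonoidAlgebra.coeff_smul, Finsupp.smul_apply, smul_eq_mul, abs_mul]
    refine mul_le_of_le_one_right (abs_nonneg _) ?_
    exact (abs_coeff_le_l1Norm _ ζ).trans l1Norm_one_le
  -- The lift of zero is f(0) Ξ_i, which the structure group fixes, so its increments vanish.
  · obtain ⟨g, hg⟩ := M.isBimap.mem t s
    rw [hlift, ← hg, structAction_mulXi, map_smul (charAction g), map_one, sub_self, homNorm_zero, zero_div,
      ENNReal.ofReal_zero]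

end Main

end BranchedRS

/-! ### The theorem -/

theorem mainTheorem11 {d : ℕ} (i : Fin d) (γ : ℝ) (hγ : γ ∈ Set.Ioo (0 : ℝ) 1)
    (α : ℝ) (hα : 0 < α) (k : ℕ) (hk : α / γ + 1 ≤ (k : ℝ))
    (f : ℝ → ℝ) (hf : ContDiff ℝ k f) (M : BranchedRS.BranchedModel d γ) :
    ∃ Φ : BranchedRS.ModelledDistribution (BranchedRS.homogeneity γ) M.Gam
          (BranchedRS.sectorY d) α →
        BranchedRS.ModelledDistribution (BranchedRS.homogeneity γ) M.Gam
          (BranchedRS.sectorYdot d) (α + γ - 1),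
      (∀ Y t, Φ Y t = BranchedRS.taylorLift γ α f i (Y t)) ∧
      Continuous Φ ∧
      ∀ K : Set ℝ, IsCompact K → ∀ D : ℝ, 0 < D → ∃ C : ℝ, 0 < C ∧
        ∀ F G : BranchedRS.ModelledDistribution (BranchedRS.homogeneity γ) M.Gam
            (BranchedRS.sectorY d) α,
          BranchedRS.mdNorm (BranchedRS.homogeneity γ) M.Gam α K F +
              BranchedRS.mdNorm (BranchedRS.homogeneity γ) M.Gam α K G ≤ ENNReal.ofReal D →
          BranchedRS.mdNorm (BranchedRS.homogeneity γ) M.Gam (α + γ - 1) K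
              (fun t => Φ F t - Φ G t) ≤
            ENNReal.ofReal C *
              BranchedRS.mdNorm (BranchedRS.homogeneity γ) M.Gam α K (fun t => F t - G t) := by
  obtain ⟨hγ0, -⟩ := hγ
  -- As k is an integer, k - 1 ≥ α/γ rounds up to k - 1 ≥ ⌈α/γ⌉: one derivative for the segment
  -- argument and ⌈α/γ⌉ for the Taylor bounds on f'.
  have hk' : ⌈α / γ⌉₊ + 1 ≤ k := by
    have h0 : 0 < α / γ := div_pos hα hγ0
    have hk1 : 1 ≤ k := by
      have : (1 : ℝ) ≤ k := by linarith
      exact_mod_cast this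
    have : ⌈α / γ⌉₊ ≤ k - 1 := by
      rw [Nat.ceil_le, Nat.cast_sub hk1, Nat.cast_one]
      linarith
    omega
  have hf' : ContDiff ℝ (⌈α / γ⌉₊ + 1 : ℕ) f := hf.of_le (by exact_mod_cast hk')
  have hlip := fun (K : Set ℝ) (hK : IsCompact K) (D : ℝ) (hD : 0 < D) =>
    BranchedRS.exists_mdNorm_taylorLift_sub_le hγ0 hα hf' M i hK hD
  let Φ : BranchedRS.ModelledDistribution (BranchedRS.homogeneity γ) M.Gam
        (BranchedRS.sectorY d) α →
      BranchedRS.ModelledDistribution (BranchedRS.homogeneity γ) M.Gam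
        (BranchedRS.sectorYdot d) (α + γ - 1) := fun Y =>
    { toFun := fun t => BranchedRS.taylorLift γ α f i (Y t)
      mem := fun t => by
        rw [BranchedRS.taylorLift_eq hγ0]
        exact BranchedRS.mulXi_trunc_mem hγ0 i _
      -- Finiteness is the Lipschitz bound against the zero distribution plus finiteness of the lift
      -- of zero; the added 1 keeps the radius positive.
      finite := fun K hK => by
        have hY := Y.finite K hK
        obtain ⟨C, -, hC⟩ := hlip K hK
          ((BranchedRS.mdNorm (BranchedRS.homogeneity γ) M.Gam α K Y).toReal + 1)
          (by positivity)
        have h := hC Y (fun _ => 0) (fun t => (Y.mem t).2) (fun _ => Submodule.zero_mem _) (by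
          rw [BranchedRS.mdNorm_zero, add_zero, ← ENNReal.ofReal_toReal hY.ne]
          exact ENNReal.ofReal_le_ofReal (by simp))
        have h2 := BranchedRS.mdNorm_sub_triangle (deg := BranchedRS.homogeneity γ) (Γ := M.Gam)
          (η := α + γ - 1) (K := K) (fun t => BranchedRS.taylorLift γ α f i (Y t))
          (fun _ => BranchedRS.taylorLift γ α f i 0) (fun _ => 0)
        simp only [sub_zero] at h h2
        exact h2.trans_lt (ENNReal.add_lt_top.2
          ⟨h.trans_lt (ENNReal.mul_lt_top ENNReal.ofReal_lt_top hY),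
            BranchedRS.mdNorm_taylorLift_zero_lt_top hγ0 hα f M i K⟩) }
  have hΦ : ∀ K : Set ℝ, IsCompact K → ∀ D : ℝ, 0 < D → ∃ C : ℝ, 0 < C ∧
      ∀ F G : BranchedRS.ModelledDistribution (BranchedRS.homogeneity γ) M.Gam
          (BranchedRS.sectorY d) α,
        BranchedRS.mdNorm (BranchedRS.homogeneity γ) M.Gam α K F +
            BranchedRS.mdNorm (BranchedRS.homogeneity γ) M.Gam α K G ≤ ENNReal.ofReal D →
        BranchedRS.mdNorm (BranchedRS.homogeneity γ) M.Gam (α + γ - 1) K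
            (fun t => Φ F t - Φ G t) ≤
          ENNReal.ofReal C *
            BranchedRS.mdNorm (BranchedRS.homogeneity γ) M.Gam α K (fun t => F t - G t) := by
    intro K hK D hD
    obtain ⟨C, hC, h⟩ := hlip K hK D hD
    exact ⟨C, hC, fun F G hFG => h F G (fun t => (F.mem t).2) (fun t => (G.mem t).2) hFG⟩
  exact ⟨Φ, fun _ _ => rfl, BranchedRS.continuous_of_locally_lipschitz Φ hΦ, hΦ⟩
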